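/- Let $\sigma_1,\sigma_2,\sigma_3$ be the Pauli matrices, $\alpha_j=\begin{pmatrix}0&\sigma_j\\ \sigma_j&0\end{pmatrix}$, $\beta=\mathrm{diag}(1,1,-1,-1)$, $\mathbf S=\frac12\begin{pmatrix}\sigma&0\\0&\sigma\end{pmatrix}$, $L=-ix\wedge\nabla$ on $\mathbb R^3$. Let $0\le\gamma/2\le\tau<\infty$. We say that $(\omega,\eta)$ has constants $(\gamma,\tau)$ if $\omega,\eta\in L^1_{loc}(\mathbb R^3)$ are positive radial functions, locally absolutely continuous in $r=|x|\in(0,\infty)$ (so that the radial derivatives $\partial_r\omega,\partial_r\eta$ exist almost everywhere), and $$\operatorname*{ess\,sup}_{x\in\mathbb R^3}\left|\frac{\partial_r\omega\cdot\eta-\omega\cdot\partial_r\eta}{\omega}\right|=\gamma,\qquad \operatorname*{ess\,inf}_{x\in\mathbb R^3}\frac{\eta(x)}{|x|}=\tau .$$ (a) If $(\omega,\eta)$ has constants $(\gamma,\tau)$ and $m\ge0$, then for every $\psi\in\mathcal S(\mathbb R^3;\mathbb C^4)$ (integrals taking values in $[0,\infty]$, with $0\cdot\infty=0$) $$\left(\tau-\tfrac\gamma2\right)^2\int\frac{|\psi|^2\omega}{\eta^2}\,dx\le\left(\tau-\tfrac\gamma2\right)^2\int\frac{|(1+2\mathbf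 S\cdot L)\psi|^2\omega}{\eta^2}\,dx\le\int|(-i\alpha\cdot\nabla+m\beta)\psi|^2\,\omega\,dx .$$ More generally, the same holds for measurable $\psi,\chi,\varphi:\mathbb R^3\to\mathbb C^4$, with $\chi$ in place of $(1+2\mathbf S\cdot L)\psi$ and $\varphi$ in place of $(-i\alpha\cdot\nabla+m\beta)\psi$, whenever there are Schwartz spinors $u_n$ with $\int|u_n-\psi|^2\omega/\eta^2\to0$, $\int|(1+2\mathbf S\cdot L)u_n-\chi|^2\omega/\eta^2\to0$ and $\int|(-i\alpha\cdot\nabla+m\beta)u_n-\varphi|^2\omega\to0$. (b) The constants are sharp. For every $(\omega,\eta)$ with constants $(\gamma,\tau)$, if $C\int|\psi|^2\omega/\eta^2\le(\tau-\gamma/2)^2\int|(1+2\mathbf S\cdot L)\psi|^2\omega/\eta^2$ for all $\psi\in C^\infty_c(\mathbb R^3;\mathbb C^4)$, then $C\le(\tau-\gamma/2)^2$. Moreover, for every $(\gamma,\tau)$ as above there is a pair $(\omega,\eta)$ with constants $(\gamma,\tau)$ such that, for every $m\ge0$, if one of the inequalities $C\int|\psi|^2\omega/\eta^2\le\int|(-i\alpha\cdot\nabla+m\beta)\psi|^2\omega$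 or $C\int|(1+2\mathbf S\cdot L)\psi|^2\omega/\eta^2\le\int|(-i\alpha\cdot\nabla+m\beta)\psi|^2\omega$ holds for all $\psi\in C^\infty_c(\mathbb R^3;\mathbb C^4)$, then $C\le(\tau-\gamma/2)^2$. -/

import Mathlib

open MeasureTheory Filter Topology
open scoped SchwartzMap ENNReal

noncomputable section

namespace HardyDirac

/-- Physical space `ℝ³` with the Euclidean norm and Lebesgue measure. -/
abbrev Space : Type := EuclideanSpace ℝ (Fin 3)

/-- Four-component spinors: `ℂ⁴`, written as `ℂ² ⊕ ℂ²` with the Euclidean norm. -/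
abbrev Spinor : Type := EuclideanSpace ℂ (Fin 2 ⊕ Fin 2)

/-- The three Pauli matrices `σ₁, σ₂, σ₃` (indexed by `0, 1, 2`). -/
def pauli : Fin 3 → Matrix (Fin 2) (Fin 2) ℂ :=
  ![!![0, 1; 1, 0], !![0, -Complex.I; Complex.I, 0], !![1, 0; 0, -1]]

/-- The Dirac matrices `α_j`, with off-diagonal blocks `σ_j`. -/
def alphaMat (j : Fin 3) : Matrix (Fin 2 ⊕ Fin 2) (Fin 2 ⊕ Fin 2) ℂ :=
  Matrix.fromBlocks 0 (pauli j) (pauli j) 0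

/-- The Dirac matrix `β = diag(1, 1, -1, -1)`. -/
def betaMat : Matrix (Fin 2 ⊕ Fin 2) (Fin 2 ⊕ Fin 2) ℂ :=
  Matrix.fromBlocks 1 0 0 (-1)

/-- The components `S_j = (1/2) diag(σ_j, σ_j)` of the spin angular momentum. -/
def spinMat (j : Fin 3) : Matrix (Fin 2 ⊕ Fin 2) (Fin 2 ⊕ Fin 2) ℂ :=
  (1 / 2 : ℂ) • Matrix.fromBlocks (pauli j) 0 0 (pauli j)

/-- Matrix acting on a spinor. -/
def act (M : Matrix (Fin 2 ⊕ Fin 2) (Fin 2 ⊕ Fin 2) ℂ) (v : Spinor) : Spinor :=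
  Matrix.toEuclideanLin M v

/-- The partial derivative `∂_j u`. -/
def partialDeriv (j : Fin 3) (u : Space → Spinor) (x : Space) : Spinor :=
  fderiv ℝ u x (EuclideanSpace.single j (1 : ℝ))

/-- The free Dirac operator `-i α·∇ + m β`. -/
def dirac (m : ℝ) (u : Space → Spinor) (x : Space) : Spinor :=
  (-Complex.I) • (∑ j : Fin 3, act (alphaMat j) (partialDeriv j u x))
    + (m : ℂ) • act betaMat (u x)

/-- The components of the orbital angular momentum `L = -i x ∧ ∇`;
indices are cyclic modulo `3`. -/
def orbital (j : Fin 3) (u : Space → Spinor) (x : Space) : Spinor :=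
  (-Complex.I) • (((x (j + 1) : ℝ) : ℂ) • partialDeriv (j + 2) u x
    - ((x (j + 2) : ℝ) : ℂ) • partialDeriv (j + 1) u x)

/-- The spin-orbit operator `1 + 2 S·L`. -/
def spinOrbit (u : Space → Spinor) (x : Space) : Spinor :=
  u x + (2 : ℂ) • ∑ j : Fin 3, act (spinMat j) (orbital j u x)

/-- `∫_{ℝ³} |u(x)|² ρ(|x|) dx`, with values in `[0, ∞]`. -/
def weightedSq (ρ : ℝ → ℝ) (u : Space → Spinor) : ℝ≥0∞ :=
  ∫⁻ x : Space, ENNReal.ofReal (‖u x‖ ^ 2 * ρ ‖x‖)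

/-- `w` is the profile of a positive radial weight `ω(x) = w(|x|)` on `ℝ³` which is locally
integrable and has a weak radial derivative in `L¹_loc(ℝ³ ∖ {0})`: equivalently, the profile is
locally absolutely continuous on `(0, ∞)`. Then `∂_r ω(x) = w'(|x|)` for almost every `x`. -/
structure IsRadialWeight (w : ℝ → ℝ) : Prop where
  pos : ∀ r : ℝ, 0 < r → 0 < w r
  locallyIntegrable : LocallyIntegrable (fun x : Space => w ‖x‖) volume
  absolutelyContinuous : ∀ a b : ℝ, 0 < a → a ≤ b → AbsolutelyContinuousOnInterval w a b

/-- The radial weights `ω(x) = w(|x|)`, `η(x) = h(|x|)` have the constants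
`γ = ess sup |(∂_r ω · η - ω · ∂_r η) / ω|` and `τ = ess inf η / |x|`. -/
structure HasHardyConstants (w h : ℝ → ℝ) (γ τ : ℝ) : Prop where
  left : IsRadialWeight w
  right : IsRadialWeight h
  essSup_eq : essSup (fun x : Space =>
    ENNReal.ofReal |(deriv w ‖x‖ * h ‖x‖ - w ‖x‖ * deriv h ‖x‖) / w ‖x‖|) volume
      = ENNReal.ofReal γ
  essInf_eq : essInf (fun x : Space => ENNReal.ofReal (h ‖x‖ / ‖x‖)) volume
      = ENNReal.ofReal τ

/-- `ψ` lies in the energy closure of the Schwartz spinors, with `χ = (1 + 2 S·L) ψ` and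
`φ = (-i α·∇ + m β) ψ` in the sense of closed operators: some Schwartz spinors `u n` satisfy
`u n → ψ` and `(1 + 2 S·L) (u n) → χ` in `L²(ω/η²)`, and `(-i α·∇ + m β) (u n) → φ`
in `L²(ω)`. -/
def IsEnergyLimit (m : ℝ) (w h : ℝ → ℝ) (ψ χ φ : Space → Spinor) : Prop :=
  AEStronglyMeasurable ψ volume ∧ AEStronglyMeasurable χ volume ∧
  AEStronglyMeasurable φ volume ∧
  ∃ u : ℕ → 𝓢(Space, Spinor),
    Tendsto (fun n => weightedSq (fun r => w r / h r ^ 2) (fun x => u n x - ψ x))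
      atTop (𝓝 0) ∧
    Tendsto (fun n => weightedSq (fun r => w r / h r ^ 2) (fun x => spinOrbit (u n) x - χ x))
      atTop (𝓝 0) ∧
    Tendsto (fun n => weightedSq w (fun x => dirac m (u n) x - φ x)) atTop (𝓝 0)

end HardyDirac

end

/-! Write D for the Dirac operator, E = x·∇, X_j for the derivative along e_j × x, J_j = -iΣ_j, A =
2S·L = ∑ J_j X_j, K = 1 + A, T = i(α·x)β and q = ω/η.

Multiplication by iα·x, which scales norms by |x|, turns D into E + 1 - K + mT. Pair this with Ku in
L²(q/r). For every radial weight K is symmetric; it commutes with E and anticommutes with T. Hence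
the mass term vanishes. Integration by parts along rays evaluates the Euler term as -⟨u,Ku⟩ in
L²(q/r) minus half of ⟨u,Ku⟩ taken with weight q'. What remains is ⟨iα·x Du, Ku⟩_{q/r} =
-½⟨u,Ku⟩_{q'} - ‖Ku‖²_{q/r}. The constants enter through |q'| ≤ γω/η² and q/r ≥ τω/η². With ‖u‖ ≤
‖Ku‖ in L²(ω/η²), the negative of the right side is at least (τ - γ/2)‖Ku‖². The negative of the
left side is at most ∫ω|Du||Ku|/η, and Young's inequality finishes (`spinOrbit_le_dirac`).

The bound K² ≥ 1 is obtained without spherical harmonics. The quaternion relations for J_j and the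
commutators of X_j give A² = -∑X_j² - A, so ‖Ku‖² = ‖u‖² + 2∑‖X_j u‖² - ‖Au‖². Since the X_j are
tangential to spheres, |Au|² ≤ 2∑|X_j u|² pointwise, where Cauchy–Schwarz alone would give the
factor 3.

All integrals converge when γ/2 < τ: then |q'| ≤ (γ/τ)q/r bounds q by powers r^{±γ/τ} with γ/τ < 2.
At γ/2 = τ the constant is zero. Limits are handled by Minkowski's inequality.

For sharpness, take radial spinors G(log|x|)e₁. There K is the identity, so the first constant is
optimal. For power weights the Dirac inequality becomes a one-dimensional inequality in t = log|x|,
tested by an exponential times a slowly varying cutoff moving to t = -∞; the mass term then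
disappears. -/

noncomputable section

namespace HardyDirac

/-! ### Schwartz spinors and operators with linear coefficients -/

/-- Schwartz spinors. -/
abbrev SchwartzSpinor : Type := 𝓢(Space, Spinor)

/-- The derivative along the linear vector field `x ↦ A x`. -/
def vectorField (A : Space →L[ℝ] Space) : SchwartzSpinor →L[ℝ] SchwartzSpinor :=
  (SchwartzMap.bilinLeftCLM (ContinuousLinearMap.id ℝ (Space →L[ℝ] Spinor))
    A.hasTemperateGrowth) ∘L SchwartzMap.fderivCLM ℝ Space Spinor

lemma vectorField_apply (A : Space →L[ℝ] Space) (u : SchwartzSpinor) (x : Space) :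
    vectorField A u x = fderiv ℝ u x (A x) := rfl

/-- A matrix as a real linear map on spinors. -/
def matL (M : Matrix (Fin 2 ⊕ Fin 2) (Fin 2 ⊕ Fin 2) ℂ) : Spinor →L[ℝ] Spinor :=
  (LinearMap.toContinuousLinearMap (Matrix.toEuclideanLin M)).restrictScalars ℝ

lemma matL_apply (M : Matrix (Fin 2 ⊕ Fin 2) (Fin 2 ⊕ Fin 2) ℂ) (v : Spinor) :
    matL M v = act M v := rfl

/-- Multiplication of Schwartz spinors by a constant linear map. -/
def constMul (T : Spinor →L[ℝ] Spinor) : SchwartzSpinor →L[ℝ] SchwartzSpinor :=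
  SchwartzMap.postcompCLM T

lemma constMul_apply (T : Spinor →L[ℝ] Spinor) (u : SchwartzSpinor) (x : Space) :
    constMul T u x = T (u x) := rfl

/-- Multiplication of Schwartz spinors by a linear map depending linearly on `x`. -/
def linMul (T : Space →L[ℝ] Spinor →L[ℝ] Spinor) : SchwartzSpinor →L[ℝ] SchwartzSpinor :=
  SchwartzMap.bilinLeftCLM (ContinuousLinearMap.id ℝ (Spinor →L[ℝ] Spinor)).flip
    T.hasTemperateGrowth

lemma linMul_apply (T : Space →L[ℝ] Spinor →L[ℝ] Spinor) (u : SchwartzSpinor) (x : Space) :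
    linMul T u x = T x (u x) := rfl

/-- The generator `x ↦ e_j × x` of the rotations about the `j`-th axis. -/
def rotGen (j : Fin 3) : Space →L[ℝ] Space :=
  (EuclideanSpace.proj (j + 1) : Space →L[ℝ] ℝ).smulRight (EuclideanSpace.single (j + 2) (1 : ℝ))
    - (EuclideanSpace.proj (j + 2) : Space →L[ℝ] ℝ).smulRight
      (EuclideanSpace.single (j + 1) (1 : ℝ))

lemma rotGen_apply (j : Fin 3) (x : Space) :
    rotGen j x = x (j + 1) • EuclideanSpace.single (j + 2) (1 : ℝ)
      - x (j + 2) • EuclideanSpace.single (j + 1) (1 : ℝ) := rfl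

/-- The matrices `-i Σ_j`, which multiply like quaternion units. -/
def quatMat (j : Fin 3) : Matrix (Fin 2 ⊕ Fin 2) (Fin 2 ⊕ Fin 2) ℂ :=
  (-Complex.I) • Matrix.fromBlocks (pauli j) 0 0 (pauli j)

/-- Multiplication by `i α · x`. -/
def alphaRad : Space →L[ℝ] Spinor →L[ℝ] Spinor :=
  ∑ j : Fin 3, (EuclideanSpace.proj j : Space →L[ℝ] ℝ).smulRight
    (matL (Complex.I • alphaMat j))

lemma alphaRad_apply (x : Space) (v : Spinor) :
    alphaRad x v = ∑ j : Fin 3, x j • act (Complex.I • alphaMat j) v := by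
  simp [alphaRad, matL_apply]

/-- Multiplication by `i (α · x) β`. -/
def alphaBetaRad : Space →L[ℝ] Spinor →L[ℝ] Spinor :=
  ∑ j : Fin 3, (EuclideanSpace.proj j : Space →L[ℝ] ℝ).smulRight
    (matL (Complex.I • (alphaMat j * betaMat)))

lemma alphaBetaRad_apply (x : Space) (v : Spinor) :
    alphaBetaRad x v = ∑ j : Fin 3, x j • act (Complex.I • (alphaMat j * betaMat)) v := by
  simp [alphaBetaRad, matL_apply]

/-- `1 + 2 S·L` as an operator on Schwartz spinors. -/
def spinOrbitOp : SchwartzSpinor →L[ℝ] SchwartzSpinor :=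
  1 + ∑ j : Fin 3, constMul (matL (quatMat j)) * vectorField (rotGen j)

lemma spinOrbitOp_apply' (u : SchwartzSpinor) (x : Space) :
    spinOrbitOp u x = u x + ∑ j : Fin 3, act (quatMat j) (vectorField (rotGen j) u x) := by
  simp [spinOrbitOp, Fin.sum_univ_three, constMul_apply, matL_apply]

lemma act_add (M : Matrix (Fin 2 ⊕ Fin 2) (Fin 2 ⊕ Fin 2) ℂ) (v w : Spinor) :
    act M (v + w) = act M v + act M w := map_add _ _ _

lemma act_mul (M N : Matrix (Fin 2 ⊕ Fin 2) (Fin 2 ⊕ Fin 2) ℂ) (v : Spinor) :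
    act M (act N v) = act (M * N) v := by
  simp [act, Matrix.toLpLin_apply]

lemma act_apply (M : Matrix (Fin 2 ⊕ Fin 2) (Fin 2 ⊕ Fin 2) ℂ) (v : Spinor)
    (i : Fin 2 ⊕ Fin 2) : act M v i = ∑ k, M i k * v k := by
  simp [act, Matrix.toLpLin_apply, Matrix.mulVec, dotProduct]

lemma vectorField_rotGen_apply (j : Fin 3) (u : SchwartzSpinor) (x : Space) :
    vectorField (rotGen j) u x
      = ((x (j + 1) : ℝ) : ℂ) • partialDeriv (j + 2) u x
        - ((x (j + 2) : ℝ) : ℂ) • partialDeriv (j + 1) u x := by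
  simp only [vectorField_apply, rotGen_apply, map_sub, map_smul, partialDeriv]
  rfl

/-- The factor -i of L moves onto the matrices, leaving the real vector fields X_j. -/
lemma spinOrbitOp_apply (u : SchwartzSpinor) (x : Space) :
    spinOrbitOp u x = spinOrbit u x := by
  rw [spinOrbitOp_apply', spinOrbit]
  congr 1
  rw [Finset.smul_sum]
  refine Finset.sum_congr rfl fun j _ => ?_
  rw [vectorField_rotGen_apply, orbital]
  generalize ((x (j + 1) : ℝ) : ℂ) • partialDeriv (j + 2) u x
        - ((x (j + 2) : ℝ) : ℂ) • partialDeriv (j + 1) u x = v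
  ext i
  simp only [act_apply, quatMat, spinMat, Matrix.smul_apply, smul_eq_mul, PiLp.smul_apply,
    Finset.mul_sum]
  refine Finset.sum_congr rfl fun k _ => ?_
  ring

/-! ### Radial decomposition of the Dirac operator and its matrix algebra -/

/-- The Euler field splits the Dirac operator into its radial and its angular part. -/
lemma alphaRad_dirac (m : ℝ) (u : SchwartzSpinor) (x : Space) :
    alphaRad x (dirac m u x) = vectorField (.id ℝ Space) u x + u x - spinOrbitOp u x
      + m • alphaBetaRad x (u x) := by
  have hE : vectorField (.id ℝ Space) u x = ∑ j : Fin 3, ((x j : ℝ) : ℂ) • partialDeriv j u x := by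
    have hx : x = ∑ j : Fin 3, x j • EuclideanSpace.single j (1 : ℝ) := by
      ext k; fin_cases k <;> simp [Fin.sum_univ_three]
    rw [vectorField_apply, ContinuousLinearMap.id_apply]
    conv_lhs =>
      rw [show fderiv ℝ u x x =
        fderiv ℝ u x (∑ j : Fin 3, x j • EuclideanSpace.single j (1 : ℝ)) by rw [← hx]]
    simp only [map_sum, map_smul, partialDeriv]
    rfl
  rw [hE, spinOrbitOp_apply', alphaRad_apply, alphaBetaRad_apply, dirac]
  simp only [vectorField_rotGen_apply]
  generalize hd : (fun j => partialDeriv j u x) = d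
  have hd' (j : Fin 3) : partialDeriv j u x = d j := congrFun hd j
  simp only [hd']
  generalize u x = v
  ext i
  rcases i with i | i <;> fin_cases i <;>
  simp [Fin.sum_univ_three, act_apply, alphaMat, betaMat, quatMat, pauli, Matrix.mul_apply,
    Fintype.sum_sum_type] <;> ring_nf <;> simp <;> ring

/-- The matrix α·x is Hermitian with square |x|². -/
lemma norm_alphaRad (x : Space) (v : Spinor) : ‖alphaRad x v‖ = ‖x‖ * ‖v‖ := by
  rw [← sq_eq_sq₀ (norm_nonneg _) (by positivity), mul_pow, EuclideanSpace.norm_sq_eq,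
    EuclideanSpace.norm_sq_eq, EuclideanSpace.norm_sq_eq, alphaRad_apply]
  simp [Fin.sum_univ_three, act_apply, alphaMat, pauli, Fintype.sum_sum_type,
    ← Complex.normSq_eq_norm_sq, Complex.normSq_apply]
  ring

lemma act_quatMat_antisymm (j : Fin 3) (v w : Spinor) :
    (inner ℂ (act (quatMat j) v) w).re = -(inner ℂ v (act (quatMat j) w)).re := by
  fin_cases j <;>
  simp [PiLp.inner_apply, Fintype.sum_sum_type, act_apply, quatMat, pauli] <;> ring

lemma alphaBetaRad_symm (x : Space) (v w : Spinor) :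
    (inner ℂ (alphaBetaRad x v) w).re = (inner ℂ v (alphaBetaRad x w)).re := by
  have h (j : Fin 3) : (inner ℂ (act (Complex.I • (alphaMat j * betaMat)) v) w).re
      = (inner ℂ v (act (Complex.I • (alphaMat j * betaMat)) w)).re := by
    have h1 : alphaMat j * betaMat = Matrix.fromBlocks 0 (-pauli j) (pauli j) 0 := by
      simp [alphaMat, betaMat, Matrix.fromBlocks_multiply]
    rw [h1]
    fin_cases j <;>
    simp [PiLp.inner_apply, Fintype.sum_sum_type, act_apply, pauli] <;> ring
  simp only [alphaBetaRad_apply, ← Complex.coe_smul, sum_inner, inner_sum, inner_smul_left,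
    inner_smul_right, Complex.conj_ofReal, Complex.re_sum, Complex.re_ofReal_mul, h]

lemma pauli_mul (j : Fin 3) :
    pauli j * pauli (j + 1) = Complex.I • pauli (j + 2) ∧
    pauli (j + 1) * pauli j = - Complex.I • pauli (j + 2) ∧ pauli j * pauli j = 1 := by
  refine ⟨?_, ?_, ?_⟩ <;> fin_cases j <;> ext i k <;> fin_cases i <;> fin_cases k <;>
    simp [pauli, Matrix.mul_apply]

lemma quatMat_mul (j : Fin 3) :
    quatMat j * quatMat (j + 1) = quatMat (j + 2) ∧
    quatMat (j + 1) * quatMat j = - quatMat (j + 2) ∧ quatMat j * quatMat j = -1 := by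
  obtain ⟨h1, h2, h3⟩ := pauli_mul j
  refine ⟨?_, ?_, ?_⟩ <;>
    simp only [quatMat, Matrix.smul_mul, Matrix.mul_smul, Matrix.fromBlocks_multiply, h1, h2, h3]
    <;> simp [smul_smul, Matrix.fromBlocks_smul, Matrix.fromBlocks_neg]

lemma pauli_anticomm (j k : Fin 3) :
    pauli j * pauli k + pauli k * pauli j = if j = k then 2 else 0 := by
  fin_cases j <;> fin_cases k <;> ext i l <;> fin_cases i <;> fin_cases l <;>
    simp [pauli, Matrix.ofNat_apply] <;> norm_num

/-- The matrix `γ₅ β`. -/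
def gammaBeta : Matrix (Fin 2 ⊕ Fin 2) (Fin 2 ⊕ Fin 2) ℂ := Matrix.fromBlocks 0 (-1) 1 0

/-- For j = k the result does not depend on j. This lets the sum over j later collapse to ∑ x_j X_j
= 0. -/
lemma quatMat_anticomm (j k : Fin 3) :
    quatMat j * (Complex.I • (alphaMat k * betaMat))
      + (Complex.I • (alphaMat k * betaMat)) * quatMat j
      = if j = k then (2 : ℂ) • gammaBeta else 0 := by
  have h2 : pauli k * pauli j = (if j = k then 2 else 0) - pauli j * pauli k := by
    rw [← pauli_anticomm j k]; abel
  simp only [quatMat, alphaMat, betaMat, Matrix.smul_mul, Matrix.mul_smul,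
    Matrix.fromBlocks_multiply, smul_smul]
  simp [Matrix.fromBlocks_add, h2, gammaBeta]
  split_ifs
  · rw [two_smul, Matrix.fromBlocks_add]
    congr 1
    · simp
    · rw [add_sub, neg_add_cancel, zero_sub, ← neg_add, one_add_one_eq_two]
    · rw [one_add_one_eq_two]
    · simp
  · simp

lemma act_quatMat_alphaBetaRad (x : Space) (v : Spinor) (j : Fin 3) :
    act (quatMat j) (alphaBetaRad x v) + alphaBetaRad x (act (quatMat j) v)
      = (2 * x j) • act gammaBeta v := by
  have hadd : ∀ M N : Matrix (Fin 2 ⊕ Fin 2) (Fin 2 ⊕ Fin 2) ℂ,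
      act (M + N) v = act M v + act N v := by
    intro M N; simp [act]
  have key (k : Fin 3) : act (quatMat j) (x k • act (Complex.I • (alphaMat k * betaMat)) v)
      + x k • act (Complex.I • (alphaMat k * betaMat)) (act (quatMat j) v)
      = if j = k then (2 * x k) • act gammaBeta v else 0 := by
    have h := congrArg (fun M => x k • act M v) (quatMat_anticomm j k)
    rw [← matL_apply, map_smul, matL_apply, ← smul_add, act_mul, act_mul, ← hadd]
    refine h.trans ?_
    split_ifs
    · ext i; simp [act_apply]; ring_nf
    · ext i; simp [act_apply]
  rw [alphaBetaRad_apply, alphaBetaRad_apply, ← matL_apply, map_sum]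
  simp only [matL_apply]
  rw [← Finset.sum_add_distrib]
  simp [key]

/-- This is the Leibniz term in A(Tu), where X_j differentiates the coefficient of T. The value -2T
turns the summand 1 of K into -1, as anticommutation requires. -/
lemma sum_act_quatMat_alphaBetaRad_rotGen (x : Space) (v : Spinor) :
    ∑ j : Fin 3, act (quatMat j) (alphaBetaRad (rotGen j x) v) = (-2 : ℝ) • alphaBetaRad x v := by
  ext i
  simp only [alphaBetaRad_apply, rotGen_apply]
  rcases i with i | i <;> fin_cases i <;>
  simp [Fin.sum_univ_three, act_apply, alphaMat, betaMat, quatMat, pauli, Matrix.mul_apply,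
    Fintype.sum_sum_type] <;> ring_nf <;> simp <;> ring

/-- This is x × x = 0. -/
lemma sum_smul_rotGen (x : Space) : ∑ j : Fin 3, x j • rotGen j x = 0 := by
  ext k
  simp only [rotGen_apply]
  fin_cases k <;> simp [Fin.sum_univ_three] <;> ring

lemma sum_smul_vectorField_rotGen (u : SchwartzSpinor) (x : Space) :
    ∑ j : Fin 3, x j • vectorField (rotGen j) u x = 0 := by
  have h := congrArg (fderiv ℝ u x) (sum_smul_rotGen x)
  simp only [map_sum, map_smul, map_zero] at h
  exact h

lemma fderiv_clm_apply_apply {E F G : Type*} [NormedAddCommGroup E] [NormedSpace ℝ E]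
    [NormedAddCommGroup F] [NormedSpace ℝ F] [NormedAddCommGroup G] [NormedSpace ℝ G]
    (T : E →L[ℝ] F →L[ℝ] G) {u : E → F} {x : E} (hu : DifferentiableAt ℝ u x) (v : E) :
    fderiv ℝ (fun y => T y (u y)) x v = T v (u x) + T x (fderiv ℝ u x v) := by
  have h := (T.hasFDerivAt (x := x)).clm_apply hu.hasFDerivAt
  rw [h.fderiv]
  simp [add_comm]

lemma coe_linMul (T : Space →L[ℝ] Spinor →L[ℝ] Spinor) (u : SchwartzSpinor) :
    (linMul T u : Space → Spinor) = fun y => T y (u y) := rfl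

lemma vectorField_linMul (A : Space →L[ℝ] Space) (T : Space →L[ℝ] Spinor →L[ℝ] Spinor)
    (u : SchwartzSpinor) (x : Space) :
    vectorField A (linMul T u) x = T (A x) (u x) + T x (vectorField A u x) := by
  rw [vectorField_apply, vectorField_apply, coe_linMul]
  exact fderiv_clm_apply_apply T u.differentiableAt (A x)

/-- The spin-orbit operator anticommutes with multiplication by `i (α · x) β`. -/
lemma spinOrbitOp_alphaBetaRad (u : SchwartzSpinor) :
    spinOrbitOp (linMul alphaBetaRad u) = -linMul alphaBetaRad (spinOrbitOp u) := by
  ext1 x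
  have h1 (j : Fin 3) := eq_sub_of_add_eq
    (act_quatMat_alphaBetaRad x (vectorField (rotGen j) u x) j)
  -- The anticommutators of J_j with T add up to a multiple of γ₅β ∑ x_j X_j u, which vanishes.
  have h2 : ∑ j : Fin 3, (2 * x j) • act gammaBeta (vectorField (rotGen j) u x) = 0 := by
    have h := congrArg (fun v => (2 : ℝ) • matL gammaBeta v) (sum_smul_vectorField_rotGen u x)
    simpa only [map_sum, map_smul, map_zero, smul_zero, Finset.smul_sum, smul_smul, matL_apply]
      using h
  simp only [neg_apply, linMul_apply, spinOrbitOp_apply', vectorField_linMul, act_add,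
    Finset.sum_add_distrib, sum_act_quatMat_alphaBetaRad_rotGen, h1, Finset.sum_sub_distrib, h2,
    map_add, map_sum]
  module

/-! ### Commutators of vector fields and the square of 2S·L -/

lemma commute_constMul_vectorField (T : Spinor →L[ℝ] Spinor) (A : Space →L[ℝ] Space) :
    Commute (constMul T) (vectorField A) := by
  ext1 u
  ext1 x
  have h : HasFDerivAt (constMul T u) _ x := T.hasFDerivAt.comp x (u.hasFDerivAt x)
  change T (vectorField A u x) = vectorField A (constMul T u) x
  rw [vectorField_apply, vectorField_apply, h.fderiv]
  rfl

lemma vectorField_vectorField (A B : Space →L[ℝ] Space) (u : SchwartzSpinor) (x : Space) :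
    vectorField A (vectorField B u) x
      = fderiv ℝ (fderiv ℝ u) x (A x) (B x) + fderiv ℝ u x (B (A x)) := by
  have h1 : HasFDerivAt (fderiv ℝ u) (fderiv ℝ (fderiv ℝ u) x) x :=
    (SchwartzMap.fderivCLM ℝ Space Spinor u).hasFDerivAt x
  have h : HasFDerivAt (vectorField B u) _ x := h1.clm_apply B.hasFDerivAt
  rw [vectorField_apply, h.fderiv]
  simp [add_comm]

/-- The second-order terms cancel by symmetry of the second derivative. -/
lemma vectorField_commutator (A B : Space →L[ℝ] Space) :
    vectorField A * vectorField B - vectorField B * vectorField A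
      = vectorField (B * A - A * B) := by
  ext1 u
  ext1 x
  have hs : IsSymmSndFDerivAt ℝ u x :=
    (u.smooth 2).contDiffAt.isSymmSndFDerivAt (by simp)
  change vectorField A (vectorField B u) x - vectorField B (vectorField A u) x = _
  rw [vectorField_vectorField, vectorField_vectorField, hs (A x) (B x), vectorField_apply]
  simp

lemma rotGen_commutator (j : Fin 3) :
    rotGen (j + 1) * rotGen j - rotGen j * rotGen (j + 1) = -rotGen (j + 2) := by
  ext x k
  fin_cases j <;> fin_cases k <;> simp [rotGen_apply]

lemma vectorField_neg (A : Space →L[ℝ] Space) : vectorField (-A) = -vectorField A := by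
  ext1 u; ext1 x
  simp [vectorField_apply]

lemma vectorField_rotGen_commutator (j : Fin 3) :
    vectorField (rotGen j) * vectorField (rotGen (j + 1))
      - vectorField (rotGen (j + 1)) * vectorField (rotGen j)
      = -vectorField (rotGen (j + 2)) := by
  rw [vectorField_commutator, rotGen_commutator, vectorField_neg]

/-- The angular part `2 S·L` of the spin-orbit operator. -/
def spinOrbitAng : SchwartzSpinor →L[ℝ] SchwartzSpinor :=
  ∑ j : Fin 3, constMul (matL (quatMat j)) * vectorField (rotGen j)

lemma constMul_mul (M N : Matrix (Fin 2 ⊕ Fin 2) (Fin 2 ⊕ Fin 2) ℂ) :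
    constMul (matL M) * constMul (matL N) = constMul (matL (M * N)) := by
  ext1 u; ext1 x
  exact act_mul M N (u x)

lemma constMul_neg (M : Matrix (Fin 2 ⊕ Fin 2) (Fin 2 ⊕ Fin 2) ℂ) :
    constMul (matL (-M)) = -constMul (matL M) := by
  ext1 u; ext1 x
  simp [constMul_apply, matL_apply, act]

lemma constMul_one : constMul (matL 1) = 1 := by
  ext1 u; ext1 x
  simp [constMul_apply, matL_apply, act]

/-- Diagonal products contribute -X_j². Off-diagonal ones pair up into J_{j+2}[X_j, X_{j+1}] =
-J_{j+2}X_{j+2}. -/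
lemma quaternion_sq {R : Type*} [Ring R] (J X : Fin 3 → R) (hJX : ∀ i j, Commute (J i) (X j))
    (hJ : ∀ j, J j * J (j + 1) = J (j + 2) ∧ J (j + 1) * J j = -J (j + 2) ∧ J j * J j = -1)
    (hX : ∀ j, X j * X (j + 1) - X (j + 1) * X j = -X (j + 2)) :
    (∑ j, J j * X j) * (∑ j, J j * X j) = -(∑ j, X j * X j) - ∑ j, J j * X j := by
  have h (i j : Fin 3) : J i * X i * (J j * X j) = J i * J j * (X i * X j) :=
    (hJX j i).symm.mul_mul_mul_comm _ _
  have h0 := hJ 0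
  have h1 := hJ 1
  have h2 := hJ 2
  have e0 := hX 0
  have e1 := hX 1
  have e2 := hX 2
  simp only [Fin.isValue, zero_add, show (1 : Fin 3) + 1 = 2 from rfl,
    show (1 : Fin 3) + 2 = 0 from rfl, show (2 : Fin 3) + 1 = 0 from rfl,
    show (2 : Fin 3) + 2 = 1 from rfl] at h0 h1 h2 e0 e1 e2
  simp only [Fin.sum_univ_three, mul_add, add_mul, h, h0.1, h0.2.1, h0.2.2, h1.1, h1.2.1, h1.2.2,
    h2.1, h2.2.1, h2.2.2]
  have f0 := congrArg (J 2 * ·) e0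
  have f1 := congrArg (J 0 * ·) e1
  have f2 := congrArg (J 1 * ·) e2
  simp only [mul_sub, mul_neg] at f0 f1 f2
  simp only [neg_mul, one_mul]
  rw [sub_eq_add_neg, neg_add, neg_add, neg_add, neg_add, ← f0, ← f1, ← f2]
  abel

lemma spinOrbitAng_sq :
    spinOrbitAng * spinOrbitAng
      = -(∑ j, vectorField (rotGen j) * vectorField (rotGen j)) - spinOrbitAng := by
  refine quaternion_sq (fun j => constMul (matL (quatMat j))) (fun j => vectorField (rotGen j))
    (fun i j => commute_constMul_vectorField _ _) (fun j => ?_) vectorField_rotGen_commutator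
  obtain ⟨h1, h2, h3⟩ := quatMat_mul j
  refine ⟨?_, ?_, ?_⟩
  · rw [constMul_mul, h1]
  · rw [constMul_mul, h2, constMul_neg]
  · rw [constMul_mul, h3, constMul_neg, constMul_one]

/-- The Euler field commutes with the spin-orbit operator. -/
lemma commute_spinOrbitOp_euler : Commute spinOrbitOp (vectorField (.id ℝ Space)) := by
  refine (Commute.one_left _).add_left (Commute.sum_left _ _ _ fun j _ => ?_)
  refine (commute_constMul_vectorField _ _).mul_left ?_
  rw [commute_iff_eq, ← sub_eq_zero, vectorField_commutator]
  ext1 u; ext1 x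
  simp [vectorField_apply]

/-! ### Rotations and averages over their orbits -/

/-- The rotation by the angle `t` about the `j`-th axis, by Rodrigues' formula. -/
def rotMap (j : Fin 3) (t : ℝ) (x : Space) : Space :=
  x + Real.sin t • rotGen j x + (1 - Real.cos t) • rotGen j (rotGen j x)

lemma norm_rotMap (j : Fin 3) (t : ℝ) (x : Space) : ‖rotMap j t x‖ = ‖x‖ := by
  rw [← sq_eq_sq₀ (norm_nonneg _) (norm_nonneg _), EuclideanSpace.norm_sq_eq,
    EuclideanSpace.norm_sq_eq]
  have h := Real.sin_sq_add_cos_sq t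
  fin_cases j <;> simp [rotMap, rotGen_apply, Fin.sum_univ_three]
  · linear_combination (x 1 ^ 2 + x 2 ^ 2) * h
  · linear_combination (x 0 ^ 2 + x 2 ^ 2) * h
  · linear_combination (x 0 ^ 2 + x 1 ^ 2) * h

/-- The rotation `rotMap` as a linear isometric equivalence. -/
def rotEquiv (j : Fin 3) (t : ℝ) : Space ≃ₗᵢ[ℝ] Space :=
  LinearIsometry.toLinearIsometryEquiv
    { toFun := rotMap j t
      map_add' := fun x y => by simp only [rotMap, map_add]; module
      map_smul' := fun c x => by simp only [rotMap, map_smul, RingHom.id_apply]; module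
      norm_map' := norm_rotMap j t } rfl

lemma measurePreserving_rotMap (j : Fin 3) (t : ℝ) : MeasurePreserving (rotMap j t) :=
  (rotEquiv j t).measurePreserving

lemma integral_comp_rotMap (j : Fin 3) (t : ℝ) (f : Space → ℝ) :
    ∫ x, f (rotMap j t x) = ∫ x, f x :=
  (measurePreserving_rotMap j t).integral_comp
    (rotEquiv j t).toHomeomorph.measurableEmbedding f

/-- This relation makes Rodrigues' formula the flow of the generator. -/
lemma rotGen_rotGen_rotGen (j : Fin 3) (x : Space) :
    rotGen j (rotGen j (rotGen j x)) = -rotGen j x := by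
  ext k
  fin_cases j <;> fin_cases k <;> simp [rotGen_apply]

lemma hasDerivAt_rotMap (j : Fin 3) (x : Space) (t : ℝ) :
    HasDerivAt (fun t => rotMap j t x) (rotGen j (rotMap j t x)) t := by
  have h := (((Real.hasDerivAt_sin t).smul_const (rotGen j x)).const_add x).add
    (((Real.hasDerivAt_cos t).const_sub 1).smul_const (rotGen j (rotGen j x)))
  refine h.congr_deriv ?_
  simp only [rotMap, map_add, map_smul, rotGen_rotGen_rotGen]
  module

lemma continuous_rotMap (j : Fin 3) : Continuous fun z : ℝ × Space => rotMap j z.1 z.2 := by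
  unfold rotMap
  fun_prop

/-- A function whose averages over the orbits of a rotation group vanish has integral zero
against every rotation invariant integrable function. -/
lemma integral_mul_eq_zero_of_rotMap (j : Fin 3) {P g : Space → ℝ} (hP : Integrable P)
    (hPinv : ∀ t x, P (rotMap j t x) = P x) (hg : Continuous g) {C : ℝ} (hC : ∀ x, |g x| ≤ C)
    (h0 : ∀ x, ∫ t in (0 : ℝ)..(2 * Real.pi), g (rotMap j t x) = 0) :
    ∫ x, P x * g x = 0 := by
  have hpi : (0 : ℝ) ≤ 2 * Real.pi := by positivity
  set μ : Measure ℝ := volume.restrict (Set.Ioc 0 (2 * Real.pi)) with hμ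
  have hint : Integrable (fun z : ℝ × Space => P z.2 * g (rotMap j z.1 z.2)) (μ.prod volume) := by
    refine (hP.comp_snd μ).mul_bdd (c := C) ?_ ?_
    · exact (hg.comp (continuous_rotMap j)).aestronglyMeasurable
    · exact Eventually.of_forall fun z => hC _
  -- By Fubini the orbit average can be taken first, and it is zero.
  have h1 : ∫ t, ∫ x, P x * g (rotMap j t x) ∂volume ∂μ = 0 := by
    rw [integral_integral_swap hint]
    refine integral_eq_zero_of_ae (Eventually.of_forall fun x => ?_)
    change ∫ t, P x * g (rotMap j t x) ∂μ = 0
    rw [integral_const_mul, hμ, ← intervalIntegral.integral_of_le hpi, h0, mul_zero]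
  -- In the other order, rotation invariance makes the inner integral independent of t, so the
  -- double integral is 2π times the integral sought.
  have h2 (t : ℝ) : ∫ x, P x * g (rotMap j t x) = ∫ x, P x * g x := by
    rw [← integral_comp_rotMap j t fun x => P x * g x]
    simp only [hPinv]
  simp only [h2, integral_const, smul_eq_mul, mul_eq_zero] at h1
  refine h1.resolve_left ?_
  simp [hμ, Measure.real, Real.pi_pos.le, Real.pi_ne_zero]

/-! ### Weighted forms on Schwartz spinors and symmetries of operators -/

/-- Radial weights against which all products of Schwartz functions are integrable. -/
def TemperedWeight (p : ℝ → ℝ) : Prop :=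
  ∃ k : ℕ, Integrable fun x : Space => p ‖x‖ / (1 + ‖x‖) ^ k

/-- The real part of the pointwise inner product of two spinor fields. -/
def reInner (u v : Space → Spinor) (x : Space) : ℝ := (inner ℂ (u x) (v x)).re

lemma reInner_self (u : Space → Spinor) (x : Space) : reInner u u x = ‖u x‖ ^ 2 :=
  inner_self_eq_norm_sq (𝕜 := ℂ) (u x)

lemma abs_reInner_le (u v : Space → Spinor) (x : Space) : |reInner u v x| ≤ ‖u x‖ * ‖v x‖ :=
  (Complex.abs_re_le_norm _).trans (norm_inner_le_norm _ _)

lemma hasFDerivAt_re_inner {E F : Type*} [NormedAddCommGroup E] [NormedSpace ℝ E]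
    [NormedAddCommGroup F] [InnerProductSpace ℂ F] [NormedSpace ℝ F] {f g : E → F}
    {f' g' : E →L[ℝ] F} {x : E} (hf : HasFDerivAt f f' x) (hg : HasFDerivAt g g' x) :
    ∃ L : E →L[ℝ] ℝ, HasFDerivAt (fun y => (inner ℂ (f y) (g y)).re) L x ∧
      ∀ v, L v = (inner ℂ (f' v) (g x)).re + (inner ℂ (f x) (g' v)).re := by
  refine ⟨_, Complex.reCLM.hasFDerivAt.comp x (hf.inner ℂ hg), fun v => ?_⟩
  simp [add_comm]

lemma hasFDerivAt_reInner (u v : SchwartzSpinor) (x : Space) :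
    ∃ L : Space →L[ℝ] ℝ, HasFDerivAt (reInner u v) L x ∧ ∀ A : Space →L[ℝ] Space,
      L (A x) = reInner (vectorField A u) v x + reInner u (vectorField A v) x := by
  obtain ⟨L, hL, hL'⟩ := hasFDerivAt_re_inner (u.hasFDerivAt x) (v.hasFDerivAt x)
  exact ⟨L, hL, fun A => hL' (A x)⟩

lemma continuous_reInner (u v : SchwartzSpinor) : Continuous (reInner u v) :=
  Complex.continuous_re.comp (u.continuous.inner v.continuous)

lemma exists_reInner_bound (u v : SchwartzSpinor) (k : ℕ) :
    ∃ C, ∀ x, |(1 + ‖x‖) ^ k * reInner u v x| ≤ C := by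
  have hu := fun x => SchwartzMap.one_add_le_sup_seminorm_apply (𝕜 := ℝ) (m := (k, 0))
    (le_refl k) (le_refl 0) u x
  have hv := fun x => SchwartzMap.one_add_le_sup_seminorm_apply (𝕜 := ℝ) (m := (0, 0))
    (le_refl 0) (le_refl 0) v x
  simp only [norm_iteratedFDeriv_zero, pow_zero, one_mul] at hu hv
  refine ⟨(2 ^ k * ((Finset.Iic (k, 0)).sup fun m => SchwartzMap.seminorm ℝ m.1 m.2) u) *
    ((Finset.Iic (0, 0)).sup fun m => SchwartzMap.seminorm ℝ m.1 m.2) v, fun x => ?_⟩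
  rw [abs_mul, abs_of_nonneg (by positivity)]
  calc (1 + ‖x‖) ^ k * |reInner u v x| ≤ (1 + ‖x‖) ^ k * (‖u x‖ * ‖v x‖) := by
        gcongr; exact abs_reInner_le _ _ _
    _ = ((1 + ‖x‖) ^ k * ‖u x‖) * ‖v x‖ := by ring
    _ ≤ _ := mul_le_mul (hu x) (hv x) (norm_nonneg _) ((by positivity : (0 : ℝ) ≤
        (1 + ‖x‖) ^ k * ‖u x‖).trans (hu x))

lemma mul_reInner_eq (p : ℝ → ℝ) (k : ℕ) (g : Space → ℝ) (x : Space) :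
    p ‖x‖ * g x = p ‖x‖ / (1 + ‖x‖) ^ k * ((1 + ‖x‖) ^ k * g x) := by
  have : (1 + ‖x‖) ^ k ≠ 0 := by positivity
  field_simp

lemma TemperedWeight.integrable {p : ℝ → ℝ} (hp : TemperedWeight p) (u v : SchwartzSpinor) :
    Integrable fun x => p ‖x‖ * reInner u v x := by
  obtain ⟨k, hk⟩ := hp
  obtain ⟨C, hC⟩ := exists_reInner_bound u v k
  simp only [mul_reInner_eq p k]
  refine hk.mul_bdd (c := C) ?_ (Eventually.of_forall hC)
  exact ((by fun_prop : Continuous fun x : Space => (1 + ‖x‖) ^ k).mul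
    (continuous_reInner u v)).aestronglyMeasurable

/-- The weighted real inner product `∫ p(|x|) Re ⟨u, v⟩ dx` of Schwartz spinors. -/
def form {p : ℝ → ℝ} (hp : TemperedWeight p) : SchwartzSpinor →ₗ[ℝ] SchwartzSpinor →ₗ[ℝ] ℝ :=
  LinearMap.mk₂ ℝ (fun u v => ∫ x, p ‖x‖ * reInner u v x)
    (fun u u' v => by
      rw [← integral_add (hp.integrable _ _) (hp.integrable _ _)]
      refine integral_congr_ae (Eventually.of_forall fun x => ?_)
      simp [reInner, mul_add])
    (fun c u v => by
      rw [smul_eq_mul, ← integral_const_mul]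
      refine integral_congr_ae (Eventually.of_forall fun x => ?_)
      simp [reInner, ← Complex.coe_smul]
      ring)
    (fun u v v' => by
      rw [← integral_add (hp.integrable _ _) (hp.integrable _ _)]
      refine integral_congr_ae (Eventually.of_forall fun x => ?_)
      simp [reInner, mul_add])
    (fun c u v => by
      rw [smul_eq_mul, ← integral_const_mul]
      refine integral_congr_ae (Eventually.of_forall fun x => ?_)
      simp [reInner, ← Complex.coe_smul]
      ring)

lemma form_apply {p : ℝ → ℝ} (hp : TemperedWeight p) (u v : SchwartzSpinor) :
    form hp u v = ∫ x, p ‖x‖ * reInner u v x := rfl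

lemma form_self {p : ℝ → ℝ} (hp : TemperedWeight p) (u : SchwartzSpinor) :
    form hp u u = ∫ x, p ‖x‖ * ‖u x‖ ^ 2 := by
  simp only [form_apply, reInner_self]

lemma reInner_comm (u v : Space → Spinor) (x : Space) : reInner u v x = reInner v u x := by
  rw [reInner, reInner, ← inner_conj_symm, Complex.conj_re]

lemma form_comm {p : ℝ → ℝ} (hp : TemperedWeight p) (u v : SchwartzSpinor) :
    form hp u v = form hp v u := by
  simp only [form_apply, reInner_comm u v]

/-- Angular derivatives are antisymmetric with respect to radial weights. -/
lemma form_vectorField_rotGen {p : ℝ → ℝ} (hp : TemperedWeight p) (j : Fin 3)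
    (u v : SchwartzSpinor) :
    form hp (vectorField (rotGen j) u) v = -form hp u (vectorField (rotGen j) v) := by
  rw [eq_neg_iff_add_eq_zero, form_apply, form_apply,
    ← integral_add (hp.integrable _ _) (hp.integrable _ _)]
  obtain ⟨k, hk⟩ := hp
  obtain ⟨C, hC⟩ := exists_reInner_bound (vectorField (rotGen j) u) v k
  obtain ⟨C', hC'⟩ := exists_reInner_bound u (vectorField (rotGen j) v) k
  have hcont : Continuous fun x : Space => (1 + ‖x‖) ^ k *
      (reInner (vectorField (rotGen j) u) v x + reInner u (vectorField (rotGen j) v) x) :=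
    (by fun_prop : Continuous fun x : Space => (1 + ‖x‖) ^ k).mul
      ((continuous_reInner _ _).add (continuous_reInner _ _))
  -- Only p/(1+|x|)^k is known to be integrable, so the factor (1+|x|)^k is given to the bounded
  -- function. It is constant on orbits.
  have key := integral_mul_eq_zero_of_rotMap j hk (fun t x => by rw [norm_rotMap])
    hcont (C := C + C') (fun x => ?_) (fun x => ?_)
  · rw [← key]
    refine integral_congr_ae (Eventually.of_forall fun x => ?_)
    simp only
    rw [← mul_reInner_eq p k (fun x => reInner (vectorField (rotGen j) u) v x
      + reInner u (vectorField (rotGen j) v) x) x, mul_add]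
  · rw [mul_add]
    exact (abs_add_le _ _).trans (add_le_add (hC x) (hC' x))
  · simp only [norm_rotMap]
    rw [intervalIntegral.integral_const_mul, mul_eq_zero]
    right
    have hd (t : ℝ) : HasDerivAt (fun t => reInner u v (rotMap j t x))
        (reInner (vectorField (rotGen j) u) v (rotMap j t x)
          + reInner u (vectorField (rotGen j) v) (rotMap j t x)) t := by
      obtain ⟨L, hL, hL'⟩ := hasFDerivAt_reInner u v (rotMap j t x)
      rw [← hL']
      exact hL.comp_hasDerivAt t (hasDerivAt_rotMap j x t)
    have hc : Continuous fun t => rotMap j t x :=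
      (continuous_rotMap j).comp (by fun_prop : Continuous fun t : ℝ => (t, x))
    -- The integrand is the derivative of Re⟨u,v⟩ along a closed orbit: the rotations by 0 and 2π
    -- coincide.
    rw [intervalIntegral.integral_eq_sub_of_hasDerivAt (fun t _ => hd t)]
    · simp [rotMap]
    · exact (((continuous_reInner _ _).comp hc).add
        ((continuous_reInner _ _).comp hc)).intervalIntegrable _ _

lemma form_constMul_quatMat {p : ℝ → ℝ} (hp : TemperedWeight p) (j : Fin 3)
    (u v : SchwartzSpinor) :
    form hp (constMul (matL (quatMat j)) u) v = -form hp u (constMul (matL (quatMat j)) v) := by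
  rw [form_apply, form_apply, ← integral_neg]
  refine integral_congr_ae (Eventually.of_forall fun x => ?_)
  simp only
  rw [← mul_neg]
  exact congrArg _ (act_quatMat_antisymm j (u x) (v x))

lemma form_alphaBetaRad {p : ℝ → ℝ} (hp : TemperedWeight p) (u v : SchwartzSpinor) :
    form hp (linMul alphaBetaRad u) v = form hp u (linMul alphaBetaRad v) := by
  rw [form_apply, form_apply]
  refine integral_congr_ae (Eventually.of_forall fun x => ?_)
  exact congrArg _ (alphaBetaRad_symm x (u x) (v x))

lemma spinOrbitAng_apply (u : SchwartzSpinor) :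
    spinOrbitAng u = ∑ j : Fin 3, constMul (matL (quatMat j)) (vectorField (rotGen j) u) := by
  simp [spinOrbitAng]

/-- Each summand J_j X_j is a product of two commuting antisymmetric operators. -/
lemma form_spinOrbitAng {p : ℝ → ℝ} (hp : TemperedWeight p) (u v : SchwartzSpinor) :
    form hp (spinOrbitAng u) v = form hp u (spinOrbitAng v) := by
  rw [spinOrbitAng_apply, spinOrbitAng_apply, map_sum, map_sum, LinearMap.sum_apply]
  refine Finset.sum_congr rfl fun j _ => ?_
  rw [form_constMul_quatMat, form_vectorField_rotGen, neg_neg]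
  congr 1
  exact (DFunLike.congr_fun (commute_constMul_vectorField (matL (quatMat j)) (rotGen j)) v).symm

lemma spinOrbitOp_eq (u : SchwartzSpinor) : spinOrbitOp u = u + spinOrbitAng u := rfl

lemma form_spinOrbitOp {p : ℝ → ℝ} (hp : TemperedWeight p) (u v : SchwartzSpinor) :
    form hp (spinOrbitOp u) v = form hp u (spinOrbitOp v) := by
  simp only [spinOrbitOp_eq, map_add, LinearMap.add_apply, form_spinOrbitAng]

/-- K and T are symmetric and anticommute, so ⟨Tu,Ku⟩ equals its own negative. This removes the mass
from the estimate. -/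
lemma form_alphaBetaRad_spinOrbitOp {p : ℝ → ℝ} (hp : TemperedWeight p) (u : SchwartzSpinor) :
    form hp (linMul alphaBetaRad u) (spinOrbitOp u) = 0 := by
  have h1 := form_spinOrbitOp hp (linMul alphaBetaRad u) u
  rw [spinOrbitOp_alphaBetaRad, map_neg, LinearMap.neg_apply, form_alphaBetaRad,
    form_comm hp (spinOrbitOp u)] at h1
  linarith

lemma form_spinOrbitAng_self {p : ℝ → ℝ} (hp : TemperedWeight p) (u : SchwartzSpinor) :
    form hp (spinOrbitAng u) (spinOrbitAng u)
      = (∑ j, form hp (vectorField (rotGen j) u) (vectorField (rotGen j) u))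
        - form hp u (spinOrbitAng u) := by
  have h := DFunLike.congr_fun spinOrbitAng_sq u
  rw [form_spinOrbitAng]
  change form hp u ((spinOrbitAng * spinOrbitAng) u) = _
  rw [h]
  simp [form_vectorField_rotGen]

/-! ### The lower bound K² ≥ 1 -/

/-- If the `v j` are tangential to `x` and the `y j` are orthogonal of the same length, then only
two of the three directions contribute to `∑ ⟨v j, y j⟩`. -/
lemma le_two_mul_sum_of_tangential {E : Type*} [NormedAddCommGroup E] [InnerProductSpace ℝ E]
    (x : Fin 3 → ℝ) (hx : ∑ j, x j ^ 2 = 1) (v y : Fin 3 → E) (N : ℝ)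
    (hy : ∀ j k, inner ℝ (y j) (y k) = if j = k then N else 0)
    (hv : ∀ z, ∑ j, x j * inner ℝ (v j) z = 0) (hs : ∑ j, inner ℝ (v j) (y j) = -N) :
    N ≤ 2 * ∑ j, ‖v j‖ ^ 2 := by
  set z := ∑ j, x j • y j with hz
  have hyz (j : Fin 3) : inner ℝ (y j) z = x j * N := by
    simp [hz, inner_sum, inner_smul_right, hy]
  have hzz : inner ℝ z z = N := by
    have : inner ℝ z z = ∑ j, x j * inner ℝ (y j) z := by
      conv_lhs => rw [hz, sum_inner]
      simp [inner_smul_left, ← hz]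
    rw [this]
    simp only [hyz]
    calc ∑ j, x j * (x j * N) = (∑ j, x j ^ 2) * N := by
          rw [Finset.sum_mul]; exact Finset.sum_congr rfl fun j _ => by ring
      _ = N := by rw [hx, one_mul]
  -- The expression is |2v_j + (y_j - x_j z)|², where y_j - x_j z is the tangential part of y. These
  -- parts have total squared length 2N instead of 3N, and tangentiality of v removes the terms with
  -- z.
  have h (j : Fin 3) : 0 ≤ 4 * ‖v j‖ ^ 2 + 4 * inner ℝ (v j) (y j) - 4 * (x j * inner ℝ (v j) z)
      + N - x j ^ 2 * N := by
    have h1 := sq_nonneg ‖(2 : ℝ) • v j + (y j - x j • z)‖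
    have h2 : ‖y j‖ ^ 2 = N := by rw [← real_inner_self_eq_norm_sq, hy, if_pos rfl]
    have h3 : ‖z‖ ^ 2 = N := by rw [← real_inner_self_eq_norm_sq, hzz]
    rw [norm_add_sq_real, norm_sub_sq_real, norm_smul, norm_smul, mul_pow, mul_pow,
      inner_sub_right, real_inner_smul_left, real_inner_smul_left, real_inner_smul_right,
      real_inner_smul_right, hyz, h2, h3] at h1
    norm_num at h1
    linarith
  have := Finset.sum_nonneg fun j (_ : j ∈ Finset.univ) => h j
  simp only [Finset.sum_add_distrib, Finset.sum_sub_distrib, ← Finset.mul_sum, ← Finset.sum_mul,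
    hv, hs, hx, Finset.sum_const, Finset.card_univ, Fintype.card_fin, nsmul_eq_mul] at this
  push_cast at this
  linarith

/-- The J_j are antisymmetric for Re⟨·,·⟩ and the product of two different ones is ± the third, so
the mixed terms reduce to Re⟨a, J a⟩ = 0. -/
lemma re_inner_quatMat (a : Spinor) (j k : Fin 3) :
    (inner ℂ (act (quatMat j) a) (act (quatMat k) a)).re = if j = k then ‖a‖ ^ 2 else 0 := by
  have hsq (j : Fin 3) : act (quatMat j) (act (quatMat j) a) = -a := by
    rw [act_mul, (quatMat_mul j).2.2]
    simp [act]
  have hanti (j : Fin 3) : (inner ℂ (act (quatMat j) a) (act (quatMat (j + 1)) a)).re = 0 := by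
    have h1 : (inner ℂ (act (quatMat j) a) (act (quatMat (j + 1)) a)).re
        = -(inner ℂ a (act (quatMat (j + 2)) a)).re := by
      rw [act_quatMat_antisymm, act_mul, (quatMat_mul j).1]
    have h2 := act_quatMat_antisymm (j + 2) a a
    have h3 : (inner ℂ (act (quatMat (j + 2)) a) a).re
        = (inner ℂ a (act (quatMat (j + 2)) a)).re := by
      rw [← inner_conj_symm, Complex.conj_re]
    linarith
  have hcomm (j k : Fin 3) : (inner ℂ (act (quatMat j) a) (act (quatMat k) a)).re
      = (inner ℂ (act (quatMat k) a) (act (quatMat j) a)).re := by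
    rw [← inner_conj_symm, Complex.conj_re]
  split_ifs with h
  · subst h
    rw [act_quatMat_antisymm, hsq, inner_neg_right, Complex.neg_re, neg_neg]
    exact inner_self_eq_norm_sq (𝕜 := ℂ) a
  · have hjk : k = j + 1 ∨ j = k + 1 := by revert j k; decide
    rcases hjk with rfl | rfl
    · exact hanti j
    · rw [hcomm]; exact hanti k

lemma Spinor.le_two_mul_sum_of_tangential (x : Fin 3 → ℝ) (hx : ∑ j, x j ^ 2 = 1)
    (v y : Fin 3 → Spinor) (N : ℝ)
    (hy : ∀ j k, (inner ℂ (y j) (y k)).re = if j = k then N else 0)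
    (hv : ∀ z, ∑ j, x j * (inner ℂ (v j) z).re = 0)
    (hs : ∑ j, (inner ℂ (v j) (y j)).re = -N) : N ≤ 2 * ∑ j, ‖v j‖ ^ 2 :=
  @HardyDirac.le_two_mul_sum_of_tangential Spinor _ (InnerProductSpace.rclikeToReal ℂ Spinor)
    x hx v y N hy hv hs

/-- Apply the tangential estimate to v_j = X_j u and y_j = J_j Au. Antisymmetry of J_j gives ∑
Re⟨X_j u, J_j Au⟩ = -|Au|². -/
lemma norm_spinOrbitAng_sq_le (u : SchwartzSpinor) {x : Space} (hx : x ≠ 0) :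
    ‖spinOrbitAng u x‖ ^ 2 ≤ 2 * ∑ j, ‖vectorField (rotGen j) u x‖ ^ 2 := by
  have hx' : ‖x‖ ≠ 0 := norm_ne_zero_iff.mpr hx
  have hs : spinOrbitAng u x = ∑ j, act (quatMat j) (vectorField (rotGen j) u x) := by
    rw [spinOrbitAng_apply, Fin.sum_univ_three, Fin.sum_univ_three]
    rfl
  refine Spinor.le_two_mul_sum_of_tangential
    (fun j => x j / ‖x‖) ?_ (fun j => vectorField (rotGen j) u x)
    (fun j => act (quatMat j) (spinOrbitAng u x)) _ (re_inner_quatMat _) ?_ ?_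
  · simp only [div_pow, ← Finset.sum_div]
    rw [EuclideanSpace.norm_sq_eq, div_eq_one_iff_eq]
    · simp
    · rw [← EuclideanSpace.norm_sq_eq]; positivity
  · intro z
    have h := congrArg (fun v => (inner ℂ v z).re / ‖x‖) (sum_smul_vectorField_rotGen u x)
    simp only [sum_inner, ← Complex.coe_smul, inner_smul_left, Complex.conj_ofReal,
      Complex.re_sum, Complex.re_ofReal_mul, Finset.sum_div, inner_zero_left, Complex.zero_re,
      zero_div] at h
    rw [← h]
    exact Finset.sum_congr rfl fun j _ => by ring
  · have h (j : Fin 3) : (inner ℂ (vectorField (rotGen j) u x)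
        (act (quatMat j) (spinOrbitAng u x))).re
        = -(inner ℂ (act (quatMat j) (vectorField (rotGen j) u x)) (spinOrbitAng u x)).re := by
      rw [act_quatMat_antisymm, neg_neg]
    simp only [h, Finset.sum_neg_distrib, ← Complex.re_sum, ← sum_inner, ← hs]
    rw [neg_inj]
    exact inner_self_eq_norm_sq (𝕜 := ℂ) (spinOrbitAng u x)

/-- The square of the spin-orbit operator is at least one. -/
lemma form_self_le_form_spinOrbitOp {p : ℝ → ℝ} (hp : TemperedWeight p) (hpos : ∀ r, 0 < r → 0 ≤ p r)
    (u : SchwartzSpinor) :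
    form hp u u ≤ form hp (spinOrbitOp u) (spinOrbitOp u) := by
  have h1 : form hp (spinOrbitAng u) (spinOrbitAng u)
      ≤ 2 * ∑ j, form hp (vectorField (rotGen j) u) (vectorField (rotGen j) u) := by
    have hi (v : SchwartzSpinor) : Integrable fun x => p ‖x‖ * ‖v x‖ ^ 2 := by
      simpa only [reInner_self] using hp.integrable v v
    simp only [form_self]
    rw [← integral_finsetSum _ fun j _ => hi _, ← integral_const_mul]
    refine integral_mono_ae (hi _) ((integrable_finsetSum _ fun j _ => hi _).const_mul _) ?_
    have : ∀ᵐ x : Space, x ≠ 0 := by simp [ae_iff]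
    filter_upwards [this] with x hx
    calc p ‖x‖ * ‖spinOrbitAng u x‖ ^ 2
        ≤ p ‖x‖ * (2 * ∑ j, ‖vectorField (rotGen j) u x‖ ^ 2) :=
          mul_le_mul_of_nonneg_left (norm_spinOrbitAng_sq_le u hx) (hpos _ (norm_pos_iff.mpr hx))
      _ = _ := by rw [← Finset.mul_sum]; ring
  -- Eliminating ⟨u,Au⟩ gives ‖Ku‖² = ‖u‖² + 2∑‖X_j u‖² - ‖Au‖², so the factor 2 above is exactly
  -- enough.
  have h2 := form_spinOrbitAng_self hp u
  simp only [spinOrbitOp_eq, map_add, LinearMap.add_apply]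
  rw [form_comm hp (spinOrbitAng u) u]
  linarith

/-! ### Polar coordinates -/

/-- The point of `ℝ³` with polar coordinates `z`. -/
def polarPoint (z : Metric.sphere (0 : Space) 1 × Set.Ioi (0 : ℝ)) : Space :=
  (z.2 : ℝ) • (z.1 : Space)

/-- The surface measure times `r² dr`. -/
def polarMeasure : Measure (Metric.sphere (0 : Space) 1 × Set.Ioi (0 : ℝ)) :=
  (volume : Measure Space).toSphere.prod (Measure.volumeIoiPow 2)

lemma polarPoint_homeomorph (x : ({0}ᶜ : Set Space)) :
    polarPoint (homeomorphUnitSphereProd Space x) = x := by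
  have hx : ‖(x : Space)‖ ≠ 0 := norm_ne_zero_iff.mpr x.2
  simp [polarPoint, smul_smul, hx]

lemma measurePreserving_polar :
    MeasurePreserving (homeomorphUnitSphereProd Space)
      ((volume : Measure Space).comap Subtype.val) polarMeasure := by
  have h := (volume : Measure Space).measurePreserving_homeomorphUnitSphereProd
  simpa [polarMeasure] using h

lemma ae_volumeIoiPow {P : ℝ → Prop} :
    (∀ᵐ r : Set.Ioi (0 : ℝ) ∂Measure.volumeIoiPow 2, P r) ↔ ∀ᵐ r ∂(volume.restrict (Set.Ioi (0 : ℝ))), P r := by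
  rw [Measure.volumeIoiPow, ae_withDensity_iff (by fun_prop),
    ae_restrict_iff_subtype measurableSet_Ioi]
  refine eventually_congr (Eventually.of_forall fun r => ?_)
  have : (0 : ℝ) < r := r.2
  simp [this.ne']

lemma integrable_polar {F : Space → ℝ} (hF : Integrable F) :
    Integrable (fun z => F (polarPoint z)) polarMeasure := by
  rw [← measurePreserving_polar.integrable_comp_emb (Homeomorph.measurableEmbedding _)]
  simp only [Function.comp_def, polarPoint_homeomorph]
  exact (integrableOn_iff_comap_subtypeVal (measurableSet_singleton 0).compl).mp hF.integrableOn

lemma integral_polar (F : Space → ℝ) : ∫ x, F x = ∫ z, F (polarPoint z) ∂polarMeasure := by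
  rw [← measurePreserving_polar.integral_comp (Homeomorph.measurableEmbedding _)]
  simp only [polarPoint_homeomorph]
  rw [integral_subtype_comap (measurableSet_singleton 0).compl fun x => F x,
    restrict_compl_singleton]

lemma integrable_volumeIoiPow {f : ℝ → ℝ} :
    Integrable (fun r : Set.Ioi (0 : ℝ) => f r) (Measure.volumeIoiPow 2) ↔
      IntegrableOn (fun r => r ^ 2 * f r) (Set.Ioi 0) := by
  rw [integrableOn_iff_comap_subtypeVal measurableSet_Ioi, Measure.volumeIoiPow,
    integrable_withDensity_iff_integrable_smul' (by fun_prop) (by simp)]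
  refine integrable_congr (Eventually.of_forall fun r => ?_)
  simp [ENNReal.toReal_ofReal (sq_nonneg (r : ℝ))]

lemma integral_volumeIoiPow (f : ℝ → ℝ) :
    ∫ r, f r ∂Measure.volumeIoiPow 2 = ∫ r in Set.Ioi (0 : ℝ), r ^ 2 * f r := by
  rw [Measure.volumeIoiPow, integral_withDensity_eq_integral_toReal_smul (by fun_prop) (by simp),
    ← integral_subtype_comap measurableSet_Ioi]
  refine integral_congr_ae (Eventually.of_forall fun r => ?_)
  simp [ENNReal.toReal_ofReal (sq_nonneg (r : ℝ))]

/-- An integral over `ℝ³` vanishes if the integral over almost every ray does. -/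
lemma integral_eq_zero_of_rays {F : Space → ℝ} (hF : Integrable F)
    (h : ∀ θ : Space, ‖θ‖ = 1 → IntegrableOn (fun r : ℝ => r ^ 2 * F (r • θ)) (Set.Ioi 0) →
      ∫ r in Set.Ioi (0 : ℝ), r ^ 2 * F (r • θ) = 0) :
    ∫ x, F x = 0 := by
  have hint := integrable_polar hF
  rw [integral_polar, polarMeasure, integral_prod _ hint]
  refine integral_eq_zero_of_ae ?_
  filter_upwards [hint.prod_right_ae] with θ hθ
  have h1 := integrable_volumeIoiPow (f := fun r => F (r • (θ : Space))).mp hθ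
  have h2 := integral_volumeIoiPow (fun r => F (r • (θ : Space)))
  simp only [polarPoint]
  rw [h2, h θ (by simp) h1]
  rfl

lemma ae_norm {P : ℝ → Prop} (h : ∀ᵐ x : Space, P ‖x‖) :
    ∀ᵐ r ∂(volume.restrict (Set.Ioi (0 : ℝ))), P r := by
  have h1 : ∀ᵐ x : ({0}ᶜ : Set Space) ∂((volume : Measure Space).comap Subtype.val),
      P ‖(x : Space)‖ := by
    exact (ae_restrict_iff_subtype (p := fun x : Space => P ‖x‖)
      (measurableSet_singleton 0).compl).mp (ae_restrict_of_ae h)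
  have h2 : ∀ᵐ z ∂polarMeasure, P (z.2 : ℝ) := by
    rw [← measurePreserving_polar.map_eq,
      (Homeomorph.measurableEmbedding (homeomorphUnitSphereProd Space)).ae_map_iff]
    simpa using h1
  have h3 := Measure.ae_ae_of_ae_prod h2
  -- The sphere has positive measure, so some direction sees the property at almost every radius.
  have : (ae (volume : Measure Space).toSphere).NeBot :=
    ae_neBot.mpr (volume : Measure Space).toSphere_ne_zero
  obtain ⟨θ, hθ⟩ := h3.exists
  exact ae_volumeIoiPow.mp hθ

lemma lintegral_norm {f : ℝ → ℝ≥0∞} (hf : Measurable f) :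
    ∫⁻ x : Space, f ‖x‖ = (volume : Measure Space).toSphere Set.univ *
      ∫⁻ r in Set.Ioi (0 : ℝ), ENNReal.ofReal (r ^ 2) * f r := by
  have h1 : ∫⁻ x : Space, f ‖x‖ = ∫⁻ z, f (z.2 : ℝ) ∂polarMeasure := by
    rw [← measurePreserving_polar.lintegral_comp_emb (Homeomorph.measurableEmbedding _)]
    simp only [homeomorphUnitSphereProd_apply_snd_coe]
    rw [lintegral_subtype_comap (measurableSet_singleton 0).compl fun x : Space => f ‖x‖,
      restrict_compl_singleton]
  rw [h1, polarMeasure, lintegral_prod _ (by fun_prop)]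
  simp only [lintegral_const]
  rw [mul_comm, Measure.volumeIoiPow, lintegral_withDensity_eq_lintegral_mul _ (by fun_prop)
    (by fun_prop), ← lintegral_subtype_comap measurableSet_Ioi]
  rfl

/-! ### Integration by parts along rays -/

/-- The fundamental theorem of calculus on `(0, ∞)` for functions vanishing at both ends. -/
lemma integral_deriv_Ioi_eq_zero {Φ : ℝ → ℝ}
    (hΦ : ∀ a b : ℝ, 0 < a → a ≤ b → AbsolutelyContinuousOnInterval Φ a b)
    (hint : IntegrableOn (deriv Φ) (Set.Ioi 0)) (h0 : Tendsto Φ (𝓝[>] 0) (𝓝 0))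
    (hinf : Tendsto Φ atTop (𝓝 0)) : ∫ r in Set.Ioi (0 : ℝ), deriv Φ r = 0 := by
  have ha : Tendsto (fun n : ℕ => 1 / ((n : ℝ) + 1)) atTop (𝓝[>] 0) :=
    tendsto_nhdsWithin_iff.mpr ⟨tendsto_one_div_add_atTop_nhds_zero_nat,
      Eventually.of_forall fun n => by simp only [Set.mem_Ioi]; positivity⟩
  have hb : Tendsto (fun n : ℕ => (n : ℝ) + 1) atTop atTop :=
    tendsto_natCast_atTop_atTop.atTop_add tendsto_const_nhds
  have hcov : AECover (volume.restrict (Set.Ioi (0 : ℝ))) atTop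
      fun n : ℕ => Set.Ioc (1 / ((n : ℝ) + 1)) ((n : ℝ) + 1) :=
    (aecover_Ioi_of_Ioi (ha.mono_right nhdsWithin_le_nhds)).inter (aecover_Iic hb)
  have h1 := hcov.integral_tendsto_of_countably_generated hint
  have h2 : Tendsto (fun n : ℕ => Φ ((n : ℝ) + 1) - Φ (1 / ((n : ℝ) + 1))) atTop (𝓝 0) := by
    simpa using (hinf.comp hb).sub (h0.comp ha)
  refine tendsto_nhds_unique h1 (h2.congr fun n => ?_)
  have hn : (0 : ℝ) < 1 / ((n : ℝ) + 1) := by positivity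
  have hle : 1 / ((n : ℝ) + 1) ≤ (n : ℝ) + 1 := by
    rw [div_le_iff₀ (by positivity)]
    nlinarith [(Nat.cast_nonneg n : (0 : ℝ) ≤ n)]
  rw [← (hΦ _ _ hn hle).integral_deriv_eq_sub, intervalIntegral.integral_of_le hle,
    Measure.restrict_restrict measurableSet_Ioc]
  congr 2
  exact (Set.inter_eq_left.mpr fun r hr => hn.trans hr.1).symm

lemma ae_Ioi_of_ae_Icc {P : ℝ → Prop}
    (h : ∀ a b : ℝ, 0 < a → a ≤ b → ∀ᵐ r, r ∈ Set.Icc a b → P r) :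
    ∀ᵐ r ∂(volume.restrict (Set.Ioi (0 : ℝ))), P r := by
  rw [ae_restrict_iff' measurableSet_Ioi]
  have h1 : ∀ᵐ r : ℝ, ∀ n : ℕ, r ∈ Set.Icc (1 / ((n : ℝ) + 1)) ((n : ℝ) + 1) → P r := by
    rw [ae_all_iff]
    intro n
    refine h _ _ (by positivity) ?_
    rw [div_le_iff₀ (by positivity)]
    nlinarith [(Nat.cast_nonneg n : (0 : ℝ) ≤ n)]
  filter_upwards [h1] with r hr hr0
  obtain ⟨n, hn⟩ := exists_nat_ge (max r (1 / r))
  have hr0' : (0 : ℝ) < r := hr0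
  refine hr n ⟨?_, ?_⟩
  · rw [one_div_le (by positivity) hr0']
    linarith [le_max_right r (1 / r)]
  · linarith [le_max_left r (1 / r)]

lemma ae_differentiableAt_Ioi {Φ : ℝ → ℝ}
    (hΦ : ∀ a b : ℝ, 0 < a → a ≤ b → AbsolutelyContinuousOnInterval Φ a b) :
    ∀ᵐ r ∂(volume.restrict (Set.Ioi (0 : ℝ))), DifferentiableAt ℝ Φ r :=
  ae_Ioi_of_ae_Icc fun a b ha hab => by
    simpa only [Set.uIcc_of_le hab] using (hΦ a b ha hab).ae_differentiableAt

/-- Integration by parts for the Euler field against a radial weight `q(|x|) / |x|`. -/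
lemma form_euler {q : ℝ → ℝ} (hp : TemperedWeight fun r => q r / r)
    (hq' : TemperedWeight (deriv q))
    (hq : ∀ a b : ℝ, 0 < a → a ≤ b → AbsolutelyContinuousOnInterval q a b)
    (h0 : Tendsto (fun r => q r * r ^ 2) (𝓝[>] 0) (𝓝 0)) {C : ℝ} {k : ℕ}
    (hinf : ∀ r, 1 ≤ r → |q r| ≤ C * r ^ k) (u v : SchwartzSpinor) :
    form hp (vectorField (.id ℝ Space) u) v + form hp u (vectorField (.id ℝ Space) v)
      = -2 * form hp u v - form hq' u v := by
  set E := vectorField (.id ℝ Space) with hE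
  suffices h : ∫ x : Space, (q ‖x‖ / ‖x‖ * reInner (E u) v x + q ‖x‖ / ‖x‖ * reInner u (E v) x
      + 2 * (q ‖x‖ / ‖x‖ * reInner u v x) + deriv q ‖x‖ * reInner u v x) = 0 by
    have i1 := hp.integrable (E u) v
    have i2 := hp.integrable u (E v)
    have i3 := hp.integrable u v
    have i4 := hq'.integrable u v
    have i12 := i1.add i2
    have i123 := i12.add (i3.const_mul 2)
    simp only [Pi.add_def] at i12 i123
    rw [integral_add i123 i4, integral_add i12 (i3.const_mul 2), integral_add i1 i2,
      integral_const_mul] at h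
    simp only [form_apply]
    linarith
  refine integral_eq_zero_of_rays ?_ fun θ hθ hint => ?_
  · exact (((hp.integrable (E u) v).add (hp.integrable u (E v))).add
      ((hp.integrable u v).const_mul 2)).add (hq'.integrable u v)
  set g : ℝ → ℝ := fun r => reInner u v (r • θ) with hg
  have hgd (r : ℝ) : ∃ d, HasDerivAt g d r ∧
      r * d = reInner (E u) v (r • θ) + reInner u (E v) (r • θ) := by
    obtain ⟨L, hL, hL'⟩ := hasFDerivAt_reInner u v (r • θ)
    have h1 : HasDerivAt (fun r : ℝ => r • θ) θ r := by
      simpa using (hasDerivAt_id r).smul_const θ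
    refine ⟨L θ, HasFDerivAt.comp_hasDerivAt (f := fun r : ℝ => r • θ) r hL h1, ?_⟩
    rw [hE, ← hL']
    simp
  have hgC : ContDiff ℝ 1 g := by
    have h1 : ContDiff ℝ 1 fun r : ℝ => r • θ := by fun_prop
    exact Complex.reCLM.contDiff.comp (((u.smooth 1).comp h1).inner ℂ ((v.smooth 1).comp h1))
  -- On a ray E is r d/dr, so r² times the integrand is exactly Φ'. The summand 2 in the formula
  -- comes from differentiating r².
  set Φ : ℝ → ℝ := fun r => q r * r ^ 2 * g r with hΦ
  have hΦac (a b : ℝ) (ha : 0 < a) (hab : a ≤ b) : AbsolutelyContinuousOnInterval Φ a b :=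
    ((hq a b ha hab).fun_mul (ContDiff.contDiffOn (by fun_prop)).absolutelyContinuousOnInterval).fun_mul
      hgC.contDiffOn.absolutelyContinuousOnInterval
  have hderiv : (fun r : ℝ => r ^ 2 * (q ‖r • θ‖ / ‖r • θ‖ * reInner (E u) v (r • θ)
      + q ‖r • θ‖ / ‖r • θ‖ * reInner u (E v) (r • θ)
      + 2 * (q ‖r • θ‖ / ‖r • θ‖ * reInner u v (r • θ))
      + deriv q ‖r • θ‖ * reInner u v (r • θ))) =ᵐ[volume.restrict (Set.Ioi 0)] deriv Φ := by
    filter_upwards [ae_differentiableAt_Ioi hq, ae_restrict_mem measurableSet_Ioi] with r hr hr0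
    have hr0' : (0 : ℝ) < r := hr0
    obtain ⟨d, hd, hd'⟩ := hgd r
    have h1 := (hr.hasDerivAt.mul (hasDerivAt_pow 2 r)).mul hd
    have h2 : ‖r • θ‖ = r := by rw [norm_smul, hθ, mul_one, Real.norm_of_nonneg hr0'.le]
    rw [show deriv Φ r = _ from h1.deriv, h2, ← mul_add, ← hd']
    simp only [hg]
    field_simp
    norm_num
    ring
  rw [integral_congr_ae hderiv]
  -- Φ grows at most like r^{k+2}|g|; one further power of decay makes it O(1/r).
  have hbd : ∃ D, ∀ r : ℝ, 0 < r → (1 + r) ^ (k + 3) * |g r| ≤ D := by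
    obtain ⟨D, hD⟩ := exists_reInner_bound u v (k + 3)
    refine ⟨D, fun r hr => ?_⟩
    have h := hD (r • θ)
    rwa [norm_smul, hθ, mul_one, Real.norm_of_nonneg hr.le, abs_mul,
      abs_of_nonneg (by positivity)] at h
  obtain ⟨D, hD⟩ := hbd
  refine integral_deriv_Ioi_eq_zero hΦac ?_ ?_ ?_
  · exact hint.congr_fun_ae hderiv
  · have hgc : Tendsto g (𝓝[>] 0) (𝓝 (g 0)) :=
      (hgC.continuous.tendsto 0).mono_left nhdsWithin_le_nhds
    simpa using h0.mul hgc
  · have hlim : Tendsto (fun r : ℝ => |C| * D * r⁻¹) atTop (𝓝 0) := by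
      simpa using tendsto_inv_atTop_zero.const_mul (|C| * D)
    refine squeeze_zero_norm' ?_ hlim
    filter_upwards [eventually_ge_atTop 1] with r hr
    have hr0 : 0 < r := by linarith
    rw [Real.norm_eq_abs, abs_mul, abs_mul, abs_of_nonneg (sq_nonneg r)]
    have h1 : |q r| ≤ |C| * r ^ k := (hinf r hr).trans (by gcongr; exact le_abs_self C)
    have h2 : r ^ (k + 3) * |g r| ≤ D := le_trans (by gcongr; linarith) (hD r hr0)
    calc |q r| * r ^ 2 * |g r| ≤ |C| * r ^ k * r ^ 2 * |g r| := by gcongr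
      _ = |C| * (r ^ (k + 3) * |g r|) * r⁻¹ := by field_simp; ring
      _ ≤ |C| * D * r⁻¹ := by gcongr

/-! ### Temperedness and power bounds for radial weights -/

lemma integrable_norm_iff {f : ℝ → ℝ} :
    Integrable (fun x : Space => f ‖x‖) ↔ IntegrableOn (fun r => r ^ 2 * f r) (Set.Ioi 0) := by
  have h := integrable_fun_norm_addHaar (volume : Measure Space) (f := f)
  simpa using h

lemma TemperedWeight.mono {p p' : ℝ → ℝ} (hp : TemperedWeight p)
    (hm : AEStronglyMeasurable p' (volume.restrict (Set.Ioi (0 : ℝ)))) {C : ℝ}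
    (hle : ∀ᵐ r ∂(volume.restrict (Set.Ioi (0 : ℝ))), |p' r| ≤ C * |p r|) :
    TemperedWeight p' := by
  obtain ⟨k, hk⟩ := hp
  refine ⟨k, ?_⟩
  rw [integrable_norm_iff (f := fun r => p r / (1 + r) ^ k)] at hk
  rw [integrable_norm_iff (f := fun r => p' r / (1 + r) ^ k)]
  refine (hk.norm.const_mul C).mono' ?_ ?_
  · exact (Measurable.aestronglyMeasurable (by fun_prop)).mul
      (hm.div₀ (Measurable.aestronglyMeasurable (by fun_prop)))
  · filter_upwards [hle] with r hr
    simp only [norm_mul, norm_div, Real.norm_eq_abs]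
    calc |r ^ 2| * (|p' r| / |(1 + r) ^ k|) ≤ |r ^ 2| * (C * |p r| / |(1 + r) ^ k|) := by gcongr
      _ = _ := by ring

/-- A weight which is less singular than `r⁻³` at the origin and grows at most linearly is
tempered. -/
lemma temperedWeight_of_le {p : ℝ → ℝ}
    (hm : AEStronglyMeasurable p (volume.restrict (Set.Ioi (0 : ℝ)))) {C s : ℝ} (hs : s < 2)
    (h0 : ∀ r, 0 < r → r ≤ 1 → |p r| ≤ C * r ^ (-s - 1)) (h1 : ∀ r, 1 ≤ r → |p r| ≤ C * r) :
    TemperedWeight p := by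
  -- At infinity this leaves r²·r/r⁶ = r⁻³; near the origin r²·r^{-s-1} = r^{1-s} is integrable
  -- because s < 2.
  refine ⟨6, ?_⟩
  rw [integrable_norm_iff (f := fun r => p r / (1 + r) ^ 6),
    ← Set.Ioc_union_Ioi_eq_Ioi (zero_le_one' ℝ)]
  have hm' : AEStronglyMeasurable (fun r => r ^ 2 * (p r / (1 + r) ^ 6))
      (volume.restrict (Set.Ioi (0 : ℝ))) :=
    (Measurable.aestronglyMeasurable (by fun_prop)).mul
      (hm.div₀ (Measurable.aestronglyMeasurable (by fun_prop)))
  refine IntegrableOn.union ?_ ?_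
  · have hi : IntegrableOn (fun r : ℝ => C * r ^ (1 - s)) (Set.Ioc 0 1) :=
      ((intervalIntegral.intervalIntegrable_rpow' (by linarith : -1 < 1 - s)).1).const_mul C
    refine hi.mono' (hm'.mono_set Set.Ioc_subset_Ioi_self) ?_
    filter_upwards [ae_restrict_mem measurableSet_Ioc] with r hr
    have hr0 : 0 < r := hr.1
    rw [norm_mul, norm_div, Real.norm_of_nonneg (sq_nonneg r),
      Real.norm_of_nonneg (by positivity : (0 : ℝ) ≤ (1 + r) ^ 6), Real.norm_eq_abs]
    calc r ^ 2 * (|p r| / (1 + r) ^ 6) ≤ r ^ 2 * |p r| := by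
          gcongr
          exact div_le_self (abs_nonneg _) (one_le_pow₀ (by linarith))
      _ ≤ r ^ 2 * (C * r ^ (-s - 1)) := by gcongr; exact h0 r hr0 hr.2
      _ = C * r ^ (1 - s) := by
          rw [← Real.rpow_natCast r 2, mul_left_comm, ← Real.rpow_add hr0]
          congr 2; push_cast; ring
  · have hi : IntegrableOn (fun r : ℝ => C * r ^ (-3 : ℝ)) (Set.Ioi 1) :=
      (integrableOn_Ioi_rpow_of_lt (by norm_num) one_pos).const_mul C
    refine hi.mono' (hm'.mono_set (Set.Ioi_subset_Ioi zero_le_one)) ?_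
    filter_upwards [ae_restrict_mem measurableSet_Ioi] with r hr
    have hr1 : 1 < r := hr
    have hr0 : 0 < r := by linarith
    have hC : 0 ≤ C * r := (abs_nonneg _).trans (h1 r hr1.le)
    rw [norm_mul, norm_div, Real.norm_of_nonneg (sq_nonneg r),
      Real.norm_of_nonneg (by positivity : (0 : ℝ) ≤ (1 + r) ^ 6), Real.norm_eq_abs]
    calc r ^ 2 * (|p r| / (1 + r) ^ 6) ≤ r ^ 2 * (C * r / r ^ 6) := by
          gcongr
          · exact h1 r hr1.le
          · linarith
      _ = C * r ^ (-3 : ℝ) := by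
          rw [Real.rpow_neg hr0.le, Real.rpow_ofNat]
          field_simp

/-- On the compact interval f is bounded below by its minimum f(x₀) > 0, and inversion is Lipschitz
on [f(x₀), ∞) with constant f(x₀)⁻². -/
lemma AbsolutelyContinuousOnInterval.inv_of_pos {f : ℝ → ℝ} {a b : ℝ}
    (hf : AbsolutelyContinuousOnInterval f a b) (hpos : ∀ x ∈ Set.uIcc a b, 0 < f x) :
    AbsolutelyContinuousOnInterval (fun x => (f x)⁻¹) a b := by
  obtain ⟨x₀, hx₀, hmin⟩ := isCompact_uIcc.exists_isMinOn Set.nonempty_uIcc hf.continuousOn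
  have hδ := hpos x₀ hx₀
  unfold _root_.AbsolutelyContinuousOnInterval at hf ⊢
  refine squeeze_zero' (Eventually.of_forall fun _ => Finset.sum_nonneg fun i hi => dist_nonneg)
    ?_ (by simpa using hf.const_mul ((f x₀ ^ 2)⁻¹))
  rw [eventually_inf_principal]
  filter_upwards with ⟨n, I⟩ hnI
  rw [Finset.mul_sum]
  refine Finset.sum_le_sum fun i hi => ?_
  obtain ⟨h1, h2⟩ := hnI.1 i hi
  have hp1 := hpos _ h1
  have hp2 := hpos _ h2
  have hm1 : f x₀ ≤ f (I i).1 := hmin h1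
  have hm2 : f x₀ ≤ f (I i).2 := hmin h2
  simp only
  rw [Real.dist_eq, Real.dist_eq, inv_sub_inv hp1.ne' hp2.ne', abs_div, abs_sub_comm,
    abs_of_pos (mul_pos hp1 hp2), div_eq_inv_mul]
  gcongr
  nlinarith

lemma continuousOn_Ioi_of_absolutelyContinuous {f : ℝ → ℝ}
    (hf : ∀ a b : ℝ, 0 < a → a ≤ b → AbsolutelyContinuousOnInterval f a b) :
    ContinuousOn f (Set.Ioi 0) := by
  intro r hr
  have hr0 : (0 : ℝ) < r := hr
  have h := (hf (r / 2) (2 * r) (by linarith) (by linarith)).continuousOn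
  rw [Set.uIcc_of_le (by linarith)] at h
  exact (h.continuousAt (Icc_mem_nhds (by linarith) (by linarith))).continuousWithinAt

lemma le_of_ae_deriv_nonneg {f : ℝ → ℝ} {a b : ℝ} (hab : a ≤ b)
    (hf : AbsolutelyContinuousOnInterval f a b)
    (h : ∀ᵐ r ∂(volume.restrict (Set.Ioc a b)), 0 ≤ deriv f r) : f a ≤ f b := by
  rw [← sub_nonneg, ← hf.integral_deriv_eq_sub, intervalIntegral.integral_of_le hab]
  exact integral_nonneg_of_ae h

/-- If `|q'| ≤ s q / r`, then `q` is squeezed between powers of `r`. -/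
lemma le_rpow_of_abs_deriv_le {q : ℝ → ℝ} {s : ℝ}
    (hq : ∀ a b : ℝ, 0 < a → a ≤ b → AbsolutelyContinuousOnInterval q a b)
    (h : ∀ᵐ r ∂(volume.restrict (Set.Ioi (0 : ℝ))), |deriv q r| ≤ s * (q r / r)) :
    (∀ r, 0 < r → r ≤ 1 → q r ≤ q 1 * r ^ (-s)) ∧ (∀ r, 1 ≤ r → q r ≤ q 1 * r ^ s) := by
  have hpow (t a b : ℝ) (ha : 0 < a) (hab : a ≤ b) :
      AbsolutelyContinuousOnInterval (fun r : ℝ => r ^ t) a b := by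
    refine ContDiffOn.absolutelyContinuousOnInterval fun r hr => ?_
    rw [Set.uIcc_of_le hab] at hr
    exact (Real.contDiffAt_rpow_const_of_ne (ha.trans_le hr.1).ne').contDiffWithinAt
  -- By the hypothesis on q' this derivative is nonnegative for t = s and nonpositive for t = -s.
  -- Comparison with r = 1 gives the two bounds.
  have hder (t : ℝ) : ∀ᵐ r ∂(volume.restrict (Set.Ioi (0 : ℝ))),
      0 < r ∧ deriv (fun r => q r * r ^ t) r = r ^ t * (deriv q r + t * (q r / r)) := by
    filter_upwards [ae_differentiableAt_Ioi hq, ae_restrict_mem measurableSet_Ioi] with r hr hr0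
    have hr0' : (0 : ℝ) < r := hr0
    refine ⟨hr0', ?_⟩
    have h1 := hr.hasDerivAt.mul (Real.hasDerivAt_rpow_const (p := t) (Or.inl hr0'.ne'))
    rw [show deriv (fun r => q r * r ^ t) r = _ from h1.deriv, Real.rpow_sub_one hr0'.ne']
    ring
  constructor
  · intro r hr0 hr1
    have h1 := le_of_ae_deriv_nonneg hr1 ((hq r 1 hr0 hr1).fun_mul (hpow s r 1 hr0 hr1)) (by
      have := (h.and (hder s))
      refine (ae_restrict_of_ae_restrict_of_subset
        (Set.Ioc_subset_Ioi_self.trans (Set.Ioi_subset_Ioi hr0.le)) this).mono ?_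
      rintro y ⟨hy, hy0, hy'⟩
      rw [hy']
      have := (abs_le.mp hy).1
      exact mul_nonneg (by positivity) (by linarith))
    rw [Real.rpow_neg hr0.le, ← div_eq_mul_inv, le_div_iff₀ (by positivity)]
    simpa using h1
  · intro r hr1
    have hr0 : 0 < r := by linarith
    have h1 := le_of_ae_deriv_nonneg hr1
      ((hq 1 r one_pos hr1).fun_mul (hpow (-s) 1 r one_pos hr1)).fun_neg (by
      have := (h.and (hder (-s)))
      refine (ae_restrict_of_ae_restrict_of_subset
        (Set.Ioc_subset_Ioi_self.trans (Set.Ioi_subset_Ioi zero_le_one)) this).mono ?_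
      rintro y ⟨hy, hy0, hy'⟩
      rw [deriv.fun_neg, hy']
      have := (abs_le.mp hy).2
      rw [Left.nonneg_neg_iff]
      exact mul_nonpos_of_nonneg_of_nonpos (by positivity) (by linarith))
    rw [Real.rpow_neg hr0.le, ← div_eq_mul_inv, Real.one_rpow, mul_one, neg_le_neg_iff,
      div_le_iff₀ (by positivity)] at h1
    exact h1

/-! ### Consequences of the constants γ and τ -/

lemma IsRadialWeight.continuousOn {w : ℝ → ℝ} (hw : IsRadialWeight w) :
    ContinuousOn w (Set.Ioi 0) :=
  continuousOn_Ioi_of_absolutelyContinuous hw.absolutelyContinuous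

namespace HasHardyConstants

variable {w h : ℝ → ℝ} {γ τ : ℝ}

lemma ae_le_ratio (H : HasHardyConstants w h γ τ) :
    ∀ᵐ r ∂(volume.restrict (Set.Ioi (0 : ℝ))), τ ≤ h r / r := by
  have h1 : ∀ᵐ x : Space, ENNReal.ofReal τ ≤ ENNReal.ofReal (h ‖x‖ / ‖x‖) := by
    rw [← H.essInf_eq]
    exact ae_essInf_le
  filter_upwards [ae_norm (P := fun r => ENNReal.ofReal τ ≤ ENNReal.ofReal (h r / r)) h1,
    ae_restrict_mem measurableSet_Ioi] with r hr hr0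
  have hr0' : (0 : ℝ) < r := hr0
  exact (ENNReal.ofReal_le_ofReal_iff (div_pos (H.right.pos r hr0') hr0').le).mp hr

lemma ae_wronskian_le (H : HasHardyConstants w h γ τ) (hγ : 0 ≤ γ) :
    ∀ᵐ r ∂(volume.restrict (Set.Ioi (0 : ℝ))),
      |deriv w r * h r - w r * deriv h r| ≤ γ * w r := by
  have h1 : ∀ᵐ x : Space, ENNReal.ofReal
      |(deriv w ‖x‖ * h ‖x‖ - w ‖x‖ * deriv h ‖x‖) / w ‖x‖| ≤ ENNReal.ofReal γ := by
    rw [← H.essSup_eq]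
    exact ENNReal.ae_le_essSup _
  filter_upwards [ae_norm (P := fun r => ENNReal.ofReal
      |(deriv w r * h r - w r * deriv h r) / w r| ≤ ENNReal.ofReal γ) h1,
    ae_restrict_mem measurableSet_Ioi] with r hr hr0
  have hw := H.left.pos r hr0
  rwa [ENNReal.ofReal_le_ofReal_iff hγ, abs_div, abs_of_pos hw, div_le_iff₀ hw] at hr

lemma absolutelyContinuous_ratio (H : HasHardyConstants w h γ τ) (a b : ℝ) (ha : 0 < a)
    (hab : a ≤ b) : AbsolutelyContinuousOnInterval (fun r => w r / h r) a b := by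
  simp only [div_eq_mul_inv]
  refine (H.left.absolutelyContinuous a b ha hab).fun_mul
    (AbsolutelyContinuousOnInterval.inv_of_pos (H.right.absolutelyContinuous a b ha hab)
      fun x hx => H.right.pos x ?_)
  rw [Set.uIcc_of_le hab] at hx
  exact ha.trans_le hx.1

/-- The Wronskian in the definition of γ is η² (ω/η)'. -/
lemma ae_abs_deriv_ratio_le (H : HasHardyConstants w h γ τ) (hγ : 0 ≤ γ) :
    ∀ᵐ r ∂(volume.restrict (Set.Ioi (0 : ℝ))),
      |deriv (fun r => w r / h r) r| ≤ γ * (w r / h r ^ 2) := by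
  filter_upwards [H.ae_wronskian_le hγ, ae_differentiableAt_Ioi H.left.absolutelyContinuous,
    ae_differentiableAt_Ioi H.right.absolutelyContinuous, ae_restrict_mem measurableSet_Ioi]
    with r hr hw hh hr0
  have hpos := H.right.pos r hr0
  rw [show deriv (fun r => w r / h r) r = _ from (hw.hasDerivAt.div hh.hasDerivAt hpos.ne').deriv,
    abs_div, abs_of_pos (by positivity : 0 < h r ^ 2), ← mul_div_assoc]
  gcongr

/-- The weight `ω / η²` is dominated by `ω / (η |x|)`. -/
lemma ae_weight_le (H : HasHardyConstants w h γ τ) :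
    ∀ᵐ r ∂(volume.restrict (Set.Ioi (0 : ℝ))), τ * (w r / h r ^ 2) ≤ w r / h r / r := by
  filter_upwards [H.ae_le_ratio, ae_restrict_mem measurableSet_Ioi] with r hr hr0
  have hr0' : (0 : ℝ) < r := hr0
  have hw := H.left.pos r hr0
  have hh := H.right.pos r hr0
  calc τ * (w r / h r ^ 2) ≤ h r / r * (w r / h r ^ 2) := by gcongr
    _ = _ := by field_simp

/-- Both constants combine into |q'| ≤ γω/η² ≤ (γ/τ) q/r. -/
lemma ratio_bounds (H : HasHardyConstants w h γ τ) (hγ : 0 ≤ γ) (hτ : 0 < τ) :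
    (∀ r, 0 < r → r ≤ 1 → w r / h r ≤ w 1 / h 1 * r ^ (-(γ / τ))) ∧
      (∀ r, 1 ≤ r → w r / h r ≤ w 1 / h 1 * r ^ (γ / τ)) := by
  refine le_rpow_of_abs_deriv_le (q := fun r => w r / h r) H.absolutelyContinuous_ratio ?_
  filter_upwards [H.ae_abs_deriv_ratio_le hγ, H.ae_weight_le] with r h1 h2
  refine h1.trans ?_
  rw [div_mul_eq_mul_div, le_div_iff₀ hτ, mul_assoc, mul_comm _ τ]
  gcongr

/-- The strict inequality γ/2 < τ makes the exponent γ/τ smaller than 2, which is what integrability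
of q/r at the origin needs. -/
lemma temperedWeight_ratio (H : HasHardyConstants w h γ τ) (hγ : 0 ≤ γ) (hτ : γ / 2 < τ) :
    TemperedWeight fun r => w r / h r / r := by
  have hτ0 : 0 < τ := by linarith
  obtain ⟨h1, h2⟩ := H.ratio_bounds hγ hτ0
  have hs : γ / τ < 2 := by rw [div_lt_iff₀ hτ0]; linarith
  have hpos (r : ℝ) (hr : 0 < r) : 0 < w r / h r := div_pos (H.left.pos r hr) (H.right.pos r hr)
  refine temperedWeight_of_le (C := w 1 / h 1) ?_ hs ?_ ?_
  · refine ContinuousOn.aestronglyMeasurable ?_ measurableSet_Ioi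
    exact (continuousOn_Ioi_of_absolutelyContinuous H.absolutelyContinuous_ratio).div
      continuousOn_id fun r hr => ne_of_gt hr
  · intro r hr0 hr1
    rw [abs_of_pos (div_pos (hpos r hr0) hr0), Real.rpow_sub_one hr0.ne', ← mul_div_assoc]
    gcongr
    exact h1 r hr0 hr1
  · intro r hr1
    have hr0 : 0 < r := by linarith
    rw [abs_of_pos (div_pos (hpos r hr0) hr0), div_le_iff₀ hr0, mul_assoc]
    refine (h2 r hr1).trans (mul_le_mul_of_nonneg_left ?_ (hpos 1 one_pos).le)
    calc r ^ (γ / τ) ≤ r ^ (2 : ℝ) := Real.rpow_le_rpow_of_exponent_le hr1 hs.le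
      _ = r * r := by rw [Real.rpow_two, sq]

lemma temperedWeight_weight (H : HasHardyConstants w h γ τ) (hγ : 0 ≤ γ) (hτ : γ / 2 < τ) :
    TemperedWeight fun r => w r / h r ^ 2 := by
  have hτ0 : 0 < τ := by linarith
  refine (H.temperedWeight_ratio hγ hτ).mono (C := τ⁻¹) ?_ ?_
  · refine ContinuousOn.aestronglyMeasurable ?_ measurableSet_Ioi
    exact H.left.continuousOn.div (H.right.continuousOn.pow 2) fun r hr =>
      pow_ne_zero 2 (H.right.pos r hr).ne'
  · filter_upwards [H.ae_weight_le, ae_restrict_mem measurableSet_Ioi] with r hr hr0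
    have hr0' : (0 : ℝ) < r := hr0
    have hw := H.left.pos r hr0
    have hh := H.right.pos r hr0
    rw [abs_of_pos (by positivity), abs_of_pos (by positivity), inv_mul_eq_div, le_div_iff₀ hτ0,
      mul_comm]
    exact hr

lemma temperedWeight_deriv (H : HasHardyConstants w h γ τ) (hγ : 0 ≤ γ) (hτ : γ / 2 < τ) :
    TemperedWeight (deriv fun r => w r / h r) := by
  refine (H.temperedWeight_weight hγ hτ).mono (C := γ)
    (measurable_deriv _).aestronglyMeasurable ?_
  filter_upwards [H.ae_abs_deriv_ratio_le hγ, ae_restrict_mem measurableSet_Ioi] with r hr hr0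
  have hw := H.left.pos r hr0
  have hh := H.right.pos r hr0
  rwa [abs_of_pos (by positivity : 0 < w r / h r ^ 2)]

end HasHardyConstants

/-! ### The inequalities for Schwartz spinors -/

lemma ae_of_ae_norm {P : ℝ → Prop} (h : ∀ᵐ r ∂(volume.restrict (Set.Ioi (0 : ℝ))), P r) :
    ∀ᵐ x : Space, P ‖x‖ := by
  have h1 : ∀ᵐ z ∂polarMeasure, P (z.2 : ℝ) :=
    Measure.quasiMeasurePreserving_snd.ae (ae_volumeIoiPow.mpr h)
  have h2 := measurePreserving_polar.quasiMeasurePreserving.ae h1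
  simp only [homeomorphUnitSphereProd_apply_snd_coe] at h2
  rw [← restrict_compl_singleton (μ := (volume : Measure Space)) 0]
  exact (ae_restrict_iff_subtype (p := fun x : Space => P ‖x‖)
      (measurableSet_singleton 0).compl).mpr h2

lemma act_continuous (M : Matrix (Fin 2 ⊕ Fin 2) (Fin 2 ⊕ Fin 2) ℂ) : Continuous (act M) :=
  (matL M).continuous

lemma continuous_dirac (m : ℝ) (u : SchwartzSpinor) : Continuous (dirac m u) := by
  have h (j : Fin 3) : Continuous (partialDeriv j u) :=
    (SchwartzMap.fderivCLM ℝ Space Spinor u).continuous.clm_apply continuous_const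
  unfold dirac
  refine Continuous.add (Continuous.const_smul ?_ (-Complex.I)) (Continuous.const_smul ?_ (m : ℂ))
  · exact continuous_finsetSum _ fun j _ => (act_continuous _).comp (h j)
  · exact (act_continuous _).comp u.continuous

lemma weightedSq_eq_ofReal_form {p : ℝ → ℝ} (hp : TemperedWeight p) (hpos : ∀ r, 0 < r → 0 ≤ p r)
    (u : SchwartzSpinor) : weightedSq p u = ENNReal.ofReal (form hp u u) := by
  have hi : Integrable fun x => p ‖x‖ * ‖u x‖ ^ 2 := by
    simpa only [reInner_self] using hp.integrable u u
  rw [form_self, ofReal_integral_eq_lintegral_ofReal hi, weightedSq]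
  · simp only [mul_comm]
  · have : ∀ᵐ x : Space, x ≠ 0 := by simp [ae_iff]
    filter_upwards [this] with x hx
    exact mul_nonneg (hpos _ (norm_pos_iff.mpr hx)) (sq_nonneg _)

lemma weightedSq_spinOrbit (ρ : ℝ → ℝ) (u : SchwartzSpinor) :
    weightedSq ρ (spinOrbit u) = weightedSq ρ (spinOrbitOp u) := by
  simp only [weightedSq, spinOrbitOp_apply]

namespace HasHardyConstants

variable {w h : ℝ → ℝ} {γ τ : ℝ}

lemma weight_nonneg (H : HasHardyConstants w h γ τ) (r : ℝ) (hr : 0 < r) :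
    0 ≤ w r / h r ^ 2 := div_nonneg (H.left.pos r hr).le (sq_nonneg _)

theorem weightedSq_le_spinOrbit (H : HasHardyConstants w h γ τ) (hγ : 0 ≤ γ) (hτ : γ / 2 < τ)
    (u : SchwartzSpinor) :
    weightedSq (fun r => w r / h r ^ 2) u ≤ weightedSq (fun r => w r / h r ^ 2) (spinOrbit u) := by
  have hp := H.temperedWeight_weight hγ hτ
  rw [weightedSq_spinOrbit, weightedSq_eq_ofReal_form hp H.weight_nonneg,
    weightedSq_eq_ofReal_form hp H.weight_nonneg]
  exact ENNReal.ofReal_le_ofReal (form_self_le_form_spinOrbitOp hp H.weight_nonneg u)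

/-- The radial component of the Dirac operator, tested against the spin-orbit operator. -/
lemma form_radial_dirac (H : HasHardyConstants w h γ τ) (hγ : 0 ≤ γ) (hτ : γ / 2 < τ) (m : ℝ)
    (u : SchwartzSpinor) :
    form (H.temperedWeight_ratio hγ hτ) (vectorField (.id ℝ Space) u + u - spinOrbitOp u
        + m • linMul alphaBetaRad u) (spinOrbitOp u)
      = -(1 / 2) * form (H.temperedWeight_deriv hγ hτ) u (spinOrbitOp u)
        - form (H.temperedWeight_ratio hγ hτ) (spinOrbitOp u) (spinOrbitOp u) := by
  have hτ0 : 0 < τ := by linarith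
  have hs : γ / τ < 2 := by rw [div_lt_iff₀ hτ0]; linarith
  obtain ⟨h1, h2⟩ := H.ratio_bounds hγ hτ0
  have hpos (r : ℝ) (hr : 0 < r) : 0 < w r / h r := div_pos (H.left.pos r hr) (H.right.pos r hr)
  -- The boundary term at the origin vanishes because q r² = O(r^{2-γ/τ}).
  have h0 : Tendsto (fun r => w r / h r * r ^ 2) (𝓝[>] 0) (𝓝 0) := by
    have hlim : Tendsto (fun r : ℝ => w 1 / h 1 * r ^ (2 - γ / τ)) (𝓝[>] 0) (𝓝 0) := by
      have := (Real.continuousAt_rpow_const 0 (2 - γ / τ) (Or.inr (by linarith))).tendsto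
      rw [Real.zero_rpow (by linarith)] at this
      simpa using (this.mono_left nhdsWithin_le_nhds).const_mul (w 1 / h 1)
    refine squeeze_zero' ?_ ?_ hlim
    · filter_upwards [self_mem_nhdsWithin] with r hr
      exact mul_nonneg (hpos r hr).le (sq_nonneg r)
    · filter_upwards [Ioc_mem_nhdsGT one_pos] with r hr
      calc w r / h r * r ^ 2 ≤ w 1 / h 1 * r ^ (-(γ / τ)) * r ^ 2 := by
            gcongr; exact h1 r hr.1 hr.2
        _ = w 1 / h 1 * r ^ (2 - γ / τ) := by
            rw [mul_assoc, ← Real.rpow_natCast r 2, ← Real.rpow_add hr.1]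
            congr 2; push_cast; ring
  have heuler := form_euler (H.temperedWeight_ratio hγ hτ) (H.temperedWeight_deriv hγ hτ)
    H.absolutelyContinuous_ratio h0 (C := w 1 / h 1) (k := 2) (fun r hr => by
      rw [abs_of_pos (hpos r (by linarith))]
      refine (h2 r hr).trans (mul_le_mul_of_nonneg_left ?_ (hpos 1 one_pos).le)
      rw [← Real.rpow_two]
      exact Real.rpow_le_rpow_of_exponent_le hr hs.le) u (spinOrbitOp u)
  -- Since K commutes with E and is symmetric, ⟨u, EKu⟩ = ⟨Eu, Ku⟩. Integration by parts therefore
  -- computes twice the Euler term.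
  have hcomm : vectorField (.id ℝ Space) (spinOrbitOp u)
      = spinOrbitOp (vectorField (.id ℝ Space) u) :=
    (DFunLike.congr_fun commute_spinOrbitOp_euler u).symm
  have hsymm := form_spinOrbitOp (H.temperedWeight_ratio hγ hτ) u (vectorField (.id ℝ Space) u)
  rw [hcomm, ← hsymm, form_comm _ (spinOrbitOp u)] at heuler
  simp only [map_add, map_sub, map_smul, LinearMap.add_apply, LinearMap.sub_apply,
    LinearMap.smul_apply, form_alphaBetaRad_spinOrbitOp, smul_zero]
  linarith

theorem spinOrbit_le_dirac (H : HasHardyConstants w h γ τ) (hγ : 0 ≤ γ) (hτ : γ / 2 < τ) (m : ℝ)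
    (u : SchwartzSpinor) :
    ENNReal.ofReal ((τ - γ / 2) ^ 2) * weightedSq (fun r => w r / h r ^ 2) (spinOrbit u)
      ≤ weightedSq w (dirac m u) := by
  by_cases htop : weightedSq w (dirac m u) = ∞
  · rw [htop]; exact le_top
  set a := τ - γ / 2 with ha
  have ha0 : 0 < a := by linarith
  have hp := H.temperedWeight_weight hγ hτ
  have hp1 := H.temperedWeight_ratio hγ hτ
  have hq' := H.temperedWeight_deriv hγ hτ
  set v := spinOrbitOp u with hv
  have hne : ∀ᵐ x : Space, x ≠ 0 := by simp [ae_iff]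
  have hmeas : AEStronglyMeasurable (fun x : Space => ‖dirac m u x‖ ^ 2 * w ‖x‖) volume :=
    ((continuous_dirac m u).norm.pow 2).aestronglyMeasurable.mul
      H.left.locallyIntegrable.aestronglyMeasurable
  have hnn : 0 ≤ᵐ[volume] fun x : Space => ‖dirac m u x‖ ^ 2 * w ‖x‖ := by
    filter_upwards [hne] with x hx
    exact mul_nonneg (sq_nonneg _) (H.left.pos _ (norm_pos_iff.mpr hx)).le
  have hint : Integrable fun x : Space => ‖dirac m u x‖ ^ 2 * w ‖x‖ :=
    ⟨hmeas, (hasFiniteIntegral_iff_ofReal hnn).mpr (lt_top_iff_ne_top.mpr htop)⟩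
  have hv2 : Integrable fun x => w ‖x‖ / h ‖x‖ ^ 2 * ‖v x‖ ^ 2 := by
    simpa only [reInner_self] using hp.integrable v v
  have hu2 : Integrable fun x => w ‖x‖ / h ‖x‖ ^ 2 * ‖u x‖ ^ 2 := by
    simpa only [reInner_self] using hp.integrable u u
  have hv1 : Integrable fun x => w ‖x‖ / h ‖x‖ / ‖x‖ * ‖v x‖ ^ 2 := by
    simpa only [reInner_self] using hp1.integrable v v
  set k := form hp v v with hk
  have hK : k = ∫ x, w ‖x‖ / h ‖x‖ ^ 2 * ‖v x‖ ^ 2 := form_self hp v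
  -- This is where τ enters, through q/r ≥ τω/η².
  have e1 : τ * k ≤ form hp1 v v := by
    rw [hK, form_self, ← integral_const_mul]
    refine integral_mono_ae (hv2.const_mul τ) hv1 ?_
    filter_upwards [ae_of_ae_norm (P := fun r => τ * (w r / h r ^ 2) ≤ w r / h r / r)
      H.ae_weight_le] with x hx
    rw [← mul_assoc]
    gcongr
  -- This is where γ enters: 2|u||Ku| ≤ |u|² + |Ku|², and ‖u‖ ≤ ‖Ku‖ by K² ≥ 1.
  have e2 : |form hq' u v| ≤ γ * k := by
    have h1 : |form hq' u v| ≤ ∫ x, γ / 2 * (w ‖x‖ / h ‖x‖ ^ 2 * ‖u x‖ ^ 2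
        + w ‖x‖ / h ‖x‖ ^ 2 * ‖v x‖ ^ 2) := by
      rw [← Real.norm_eq_abs, form_apply]
      refine norm_integral_le_of_norm_le ((hu2.add hv2).const_mul _) ?_
      filter_upwards [hne, ae_of_ae_norm (P := fun r => |deriv (fun r => w r / h r) r|
        ≤ γ * (w r / h r ^ 2)) (H.ae_abs_deriv_ratio_le hγ)] with x hx0 hx
      have hw := H.weight_nonneg _ (norm_pos_iff.mpr hx0)
      rw [norm_mul, Real.norm_eq_abs, Real.norm_eq_abs]
      calc _ ≤ γ * (w ‖x‖ / h ‖x‖ ^ 2) * (‖u x‖ * ‖v x‖) := by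
            gcongr; exact abs_reInner_le u v x
        _ ≤ γ * (w ‖x‖ / h ‖x‖ ^ 2) * ((‖u x‖ ^ 2 + ‖v x‖ ^ 2) / 2) := by
            gcongr; linarith [two_mul_le_add_sq ‖u x‖ ‖v x‖]
        _ = _ := by ring
    rw [integral_const_mul, integral_add hu2 hv2, ← hK, ← form_self hp u] at h1
    have h2 := form_self_le_form_spinOrbitOp hp H.weight_nonneg u
    rw [← hv, ← hk] at h2
    nlinarith
  obtain ⟨D, hD⟩ : ∃ D, D = vectorField (.id ℝ Space) u + u - v + m • linMul alphaBetaRad u :=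
    ⟨_, rfl⟩
  -- Since |iα·x Du| = |x||Du|, the weight q/r leaves ω|Du||Ku|/η. Young's inequality with parameter
  -- a = τ - γ/2 loses nothing when half of a·k is absorbed below.
  have e3 : -form hp1 D v
      ≤ 1 / (2 * a) * (∫ x, ‖dirac m u x‖ ^ 2 * w ‖x‖) + a / 2 * k := by
    rw [hK, form_apply, ← integral_neg, ← integral_const_mul, ← integral_const_mul,
      ← integral_add (hint.const_mul _) (hv2.const_mul _)]
    refine integral_mono_ae (hp1.integrable _ _).neg
      ((hint.const_mul _).add (hv2.const_mul _)) ?_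
    filter_upwards [hne] with x hx0
    have hr := norm_pos_iff.mpr hx0
    have hw := H.left.pos _ hr
    have hh := H.right.pos _ hr
    have h1 : D x = alphaRad x (dirac m u x) := by rw [hD]; exact (alphaRad_dirac m u x).symm
    have h2 := abs_reInner_le D v x
    rw [h1, norm_alphaRad] at h2
    calc _ ≤ w ‖x‖ / h ‖x‖ / ‖x‖ * (‖x‖ * ‖dirac m u x‖ * ‖v x‖) := by
          rw [← mul_neg]
          gcongr
          exact (neg_le_abs _).trans h2
      _ = w ‖x‖ * (‖dirac m u x‖ * (‖v x‖ / h ‖x‖)) := by field_simp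
      _ ≤ w ‖x‖ * (1 / (2 * a) * ‖dirac m u x‖ ^ 2 + a / 2 * (‖v x‖ / h ‖x‖) ^ 2) := by
          gcongr
          have := sq_nonneg (‖dirac m u x‖ - a * (‖v x‖ / h ‖x‖))
          rw [← sub_nonneg]
          have e : 1 / (2 * a) * ‖dirac m u x‖ ^ 2 + a / 2 * (‖v x‖ / h ‖x‖) ^ 2
              - ‖dirac m u x‖ * (‖v x‖ / h ‖x‖)
              = 1 / (2 * a) * (‖dirac m u x‖ - a * (‖v x‖ / h ‖x‖)) ^ 2 := by
            field_simp; ring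
          rw [e]; positivity
      _ = _ := by field_simp
  rw [hD, H.form_radial_dirac hγ hτ m u] at e3
  have e4 := (abs_le.mp e2).1
  have e5 : a ^ 2 * k ≤ ∫ x, ‖dirac m u x‖ ^ 2 * w ‖x‖ := by
    have h1 : a * k ≤ 1 / (2 * a) * (∫ x, ‖dirac m u x‖ ^ 2 * w ‖x‖) + a / 2 * k := by
      refine le_trans ?_ e3
      rw [ha]
      linarith
    have h2 : a / 2 * k ≤ 1 / (2 * a) * (∫ x, ‖dirac m u x‖ ^ 2 * w ‖x‖) := by linarith
    have h3 := mul_le_mul_of_nonneg_left h2 (by positivity : 0 ≤ 2 * a)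
    calc a ^ 2 * k = 2 * a * (a / 2 * k) := by ring
      _ ≤ _ := h3
      _ = _ := by field_simp
  rw [weightedSq_spinOrbit, weightedSq_eq_ofReal_form hp H.weight_nonneg,
    ← ENNReal.ofReal_mul (sq_nonneg a), weightedSq,
    ← ofReal_integral_eq_lintegral_ofReal hint hnn]
  exact ENNReal.ofReal_le_ofReal e5

end HasHardyConstants

/-! ### Passage to energy limits -/

/-- This is Minkowski's inequality in L², with √ρ absorbed into the functions. Negative values of ρ
count as zero, so no sign condition is needed. -/
lemma weightedSq_rpow_add_le {ρ : ℝ → ℝ}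
    (hm : AEStronglyMeasurable (fun x : Space => ρ ‖x‖) volume) {u v : Space → Spinor}
    (hu : AEStronglyMeasurable u volume) (hv : AEStronglyMeasurable v volume) :
    weightedSq ρ (fun x => u x + v x) ^ (1 / 2 : ℝ)
      ≤ weightedSq ρ u ^ (1 / 2 : ℝ) + weightedSq ρ v ^ (1 / 2 : ℝ) := by
  have key (f : Space → Spinor) : weightedSq ρ f
      = ∫⁻ x, (‖f x‖ₑ * ENNReal.ofReal (ρ ‖x‖) ^ (1 / 2 : ℝ)) ^ (2 : ℝ) := by
    refine lintegral_congr fun x => ?_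
    rw [ENNReal.mul_rpow_of_nonneg _ _ (by norm_num), ← ENNReal.rpow_mul,
      ENNReal.ofReal_mul (by positivity), ← ofReal_norm, ENNReal.rpow_two,
      ENNReal.ofReal_pow (norm_nonneg _)]
    norm_num
  have hρ : AEMeasurable (fun x : Space => ENNReal.ofReal (ρ ‖x‖) ^ (1 / 2 : ℝ)) volume :=
    hm.aemeasurable.ennreal_ofReal.pow_const _
  rw [key, key, key]
  refine le_trans ?_ (ENNReal.lintegral_Lp_add_le (hu.enorm.mul hρ) (hv.enorm.mul hρ) one_le_two)
  refine ENNReal.rpow_le_rpow (lintegral_mono fun x => ?_) (by norm_num)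
  refine ENNReal.rpow_le_rpow ?_ (by norm_num)
  simp only [Pi.add_apply]
  rw [← add_mul]
  gcongr
  exact enorm_add_le _ _

/-- Weighted inequalities pass to limits. -/
lemma weightedSq_le_of_tendsto {ρ₁ ρ₂ : ℝ → ℝ}
    (hm₁ : AEStronglyMeasurable (fun x : Space => ρ₁ ‖x‖) volume)
    (hm₂ : AEStronglyMeasurable (fun x : Space => ρ₂ ‖x‖) volume)
    {u v : ℕ → Space → Spinor} {ψ φ : Space → Spinor} {c : ℝ≥0∞} (hc : c ≠ ∞)
    (hu : ∀ n, AEStronglyMeasurable (u n) volume) (hv : ∀ n, AEStronglyMeasurable (v n) volume)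
    (hψ : AEStronglyMeasurable ψ volume) (hφ : AEStronglyMeasurable φ volume)
    (hle : ∀ n, c * weightedSq ρ₁ (u n) ≤ weightedSq ρ₂ (v n))
    (h₁ : Tendsto (fun n => weightedSq ρ₁ (fun x => u n x - ψ x)) atTop (𝓝 0))
    (h₂ : Tendsto (fun n => weightedSq ρ₂ (fun x => v n x - φ x)) atTop (𝓝 0)) :
    c * weightedSq ρ₁ ψ ≤ weightedSq ρ₂ φ := by
  have hhalf : (0 : ℝ) < 1 / 2 := by norm_num
  rw [← ENNReal.rpow_le_rpow_iff hhalf]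
  have hr {f : ℕ → ℝ≥0∞} (hf : Tendsto f atTop (𝓝 0)) :
      Tendsto (fun n => f n ^ (1 / 2 : ℝ)) atTop (𝓝 0) := by
    have := hf.ennrpow_const (1 / 2)
    rwa [ENNReal.zero_rpow_of_pos hhalf] at this
  have hlim : Tendsto (fun n => weightedSq ρ₂ φ ^ (1 / 2 : ℝ)
      + weightedSq ρ₂ (fun x => v n x - φ x) ^ (1 / 2 : ℝ)
      + c ^ (1 / 2 : ℝ) * weightedSq ρ₁ (fun x => u n x - ψ x) ^ (1 / 2 : ℝ)) atTop
      (𝓝 (weightedSq ρ₂ φ ^ (1 / 2 : ℝ))) := by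
    have h3 := ENNReal.Tendsto.const_mul (a := c ^ (1 / 2 : ℝ)) (hr h₁)
      (Or.inr (ENNReal.rpow_ne_top_of_nonneg hhalf.le hc))
    simpa using (tendsto_const_nhds.add (hr h₂)).add h3
  refine ge_of_tendsto' hlim fun n => ?_
  have hneg : weightedSq ρ₁ (fun x => ψ x - u n x) = weightedSq ρ₁ (fun x => u n x - ψ x) := by
    simp only [weightedSq, norm_sub_rev]
  have t1 := weightedSq_rpow_add_le hm₁ (hu n) (hψ.sub (hu n))
  have t2 := weightedSq_rpow_add_le hm₂ hφ ((hv n).sub hφ)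
  simp only [Pi.sub_apply, add_sub_cancel] at t1 t2
  have e1 : weightedSq ρ₁ (ψ - u n) = weightedSq ρ₁ (fun x => u n x - ψ x) := hneg
  rw [e1] at t1
  have hle' := ENNReal.rpow_le_rpow (hle n) hhalf.le
  rw [ENNReal.mul_rpow_of_nonneg _ _ hhalf.le] at hle' ⊢
  calc c ^ (1 / 2 : ℝ) * weightedSq ρ₁ ψ ^ (1 / 2 : ℝ)
      ≤ c ^ (1 / 2 : ℝ) * weightedSq ρ₁ (u n) ^ (1 / 2 : ℝ)
        + c ^ (1 / 2 : ℝ) * weightedSq ρ₁ (fun x => u n x - ψ x) ^ (1 / 2 : ℝ) := by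
        rw [← mul_add]; gcongr
    _ ≤ _ := by gcongr; exact hle'.trans t2

theorem HasHardyConstants.inequalities {w h : ℝ → ℝ} {γ τ : ℝ} (H : HasHardyConstants w h γ τ)
    (hγ : 0 ≤ γ) (hτ : γ / 2 ≤ τ) (m : ℝ) (u : SchwartzSpinor) :
    ENNReal.ofReal ((τ - γ / 2) ^ 2) * weightedSq (fun r => w r / h r ^ 2) u
      ≤ ENNReal.ofReal ((τ - γ / 2) ^ 2) * weightedSq (fun r => w r / h r ^ 2) (spinOrbit u) ∧
    ENNReal.ofReal ((τ - γ / 2) ^ 2) * weightedSq (fun r => w r / h r ^ 2) (spinOrbit u)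
      ≤ weightedSq w (dirac m u) := by
  -- In the equality case the constant is zero, and 0·∞ = 0; the forms need not converge there.
  rcases hτ.eq_or_lt with h0 | h0
  · simp [← h0]
  · exact ⟨mul_le_mul_right (H.weightedSq_le_spinOrbit hγ h0 u) _, H.spinOrbit_le_dirac hγ h0 m u⟩

theorem HasHardyConstants.inequalities_of_isEnergyLimit {w h : ℝ → ℝ} {γ τ : ℝ}
    (H : HasHardyConstants w h γ τ) (hγ : 0 ≤ γ) (hτ : γ / 2 ≤ τ) (m : ℝ)
    {ψ χ φ : Space → Spinor} (hlim : IsEnergyLimit m w h ψ χ φ) :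
    ENNReal.ofReal ((τ - γ / 2) ^ 2) * weightedSq (fun r => w r / h r ^ 2) ψ
      ≤ ENNReal.ofReal ((τ - γ / 2) ^ 2) * weightedSq (fun r => w r / h r ^ 2) χ ∧
    ENNReal.ofReal ((τ - γ / 2) ^ 2) * weightedSq (fun r => w r / h r ^ 2) χ
      ≤ weightedSq w φ := by
  rcases hτ.eq_or_lt with h0 | h0
  · simp [← h0]
  obtain ⟨hψ, hχ, hφ, u, hu, hKu, hDu⟩ := hlim
  have hm₁ : AEStronglyMeasurable (fun x : Space => w ‖x‖ / h ‖x‖ ^ 2) volume :=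
    H.left.locallyIntegrable.aestronglyMeasurable.div₀
      (H.right.locallyIntegrable.aestronglyMeasurable.pow 2)
  have hm₂ := H.left.locallyIntegrable.aestronglyMeasurable
  have hu' (n : ℕ) : AEStronglyMeasurable (u n) volume := (u n).continuous.aestronglyMeasurable
  have hK' (n : ℕ) : AEStronglyMeasurable (spinOrbit (u n)) volume := by
    have : spinOrbit (u n) = spinOrbitOp (u n) := funext fun x => (spinOrbitOp_apply _ x).symm
    rw [this]
    exact (spinOrbitOp (u n)).continuous.aestronglyMeasurable
  have hD' (n : ℕ) : AEStronglyMeasurable (dirac m (u n)) volume :=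
    (continuous_dirac m (u n)).aestronglyMeasurable
  constructor
  · refine mul_le_mul_right ?_ _
    have h1 := weightedSq_le_of_tendsto (ρ₁ := fun r => w r / h r ^ 2)
      (ρ₂ := fun r => w r / h r ^ 2) hm₁ hm₁ ENNReal.one_ne_top hu' hK' hψ hχ
      (fun n => by rw [one_mul]; exact H.weightedSq_le_spinOrbit hγ h0 (u n)) hu hKu
    rwa [one_mul] at h1
  · exact weightedSq_le_of_tendsto (ρ₁ := fun r => w r / h r ^ 2) hm₁ hm₂ ENNReal.ofReal_ne_top
      hK' hD' hχ hφ (fun n => H.spinOrbit_le_dirac hγ h0 m (u n)) hKu hDu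

/-! ### Radial test spinors in logarithmic coordinates -/

open scoped ContDiff

lemma lintegral_norm_of_aemeasurable {f : ℝ → ℝ≥0∞}
    (hf : AEMeasurable f (volume.restrict (Set.Ioi (0 : ℝ)))) :
    ∫⁻ x : Space, f ‖x‖ = (volume : Measure Space).toSphere Set.univ *
      ∫⁻ r in Set.Ioi (0 : ℝ), ENNReal.ofReal (r ^ 2) * f r := by
  have h1 : ∫⁻ x : Space, f ‖x‖ = ∫⁻ x : Space, hf.mk f ‖x‖ :=
    lintegral_congr_ae (ae_of_ae_norm (P := fun r => f r = hf.mk f r) hf.ae_eq_mk)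
  rw [h1, lintegral_norm hf.measurable_mk]
  congr 1
  refine lintegral_congr_ae ?_
  filter_upwards [hf.ae_eq_mk] with r hr
  rw [hr]

/-- Integration in logarithmic polar coordinates. -/
lemma lintegral_norm_exp {f : ℝ → ℝ≥0∞}
    (hf : AEMeasurable f (volume.restrict (Set.Ioi (0 : ℝ)))) :
    ∫⁻ x : Space, f ‖x‖ = (volume : Measure Space).toSphere Set.univ *
      ∫⁻ t : ℝ, ENNReal.ofReal (Real.exp (3 * t)) * f (Real.exp t) := by
  rw [lintegral_norm_of_aemeasurable hf]
  congr 1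
  have h := lintegral_image_eq_lintegral_abs_deriv_mul (s := Set.univ) MeasurableSet.univ
    (fun t _ => (Real.hasDerivAt_exp t).hasDerivWithinAt) Real.exp_injective.injOn
    (fun r => ENNReal.ofReal (r ^ 2) * f r)
  rw [Set.image_univ, Real.range_exp, setLIntegral_univ] at h
  rw [h]
  refine lintegral_congr fun t => ?_
  rw [← mul_assoc, ← ENNReal.ofReal_mul (abs_nonneg _), abs_of_pos (Real.exp_pos t),
    ← Real.exp_nat_mul, ← Real.exp_add]
  congr 3
  push_cast
  ring

/-- The spinor `e₁`, as a constant. -/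
def spinUp : Spinor := EuclideanSpace.single (Sum.inl 0) 1

/-- The spinor field `G(log |x|) e₁`. -/
def logRadial (G : ℝ → ℝ) (x : Space) : Spinor := G (Real.log (‖x‖ ^ 2) / 2) • spinUp

lemma norm_spinUp : ‖spinUp‖ = 1 := by simp [spinUp]

/-- The definition uses |x|² because its smoothness and gradient are immediate; the estimates use
log|x|. -/
lemma log_norm_sq (x : Space) : Real.log (‖x‖ ^ 2) / 2 = Real.log ‖x‖ := by
  rw [Real.log_pow]; push_cast; ring

lemma norm_logRadial_sq (G : ℝ → ℝ) (x : Space) :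
    ‖logRadial G x‖ ^ 2 = G (Real.log ‖x‖) ^ 2 := by
  rw [logRadial, log_norm_sq, norm_smul, norm_spinUp, mul_one, Real.norm_eq_abs, sq_abs]

section logRadial

variable {G : ℝ → ℝ} {A : ℝ}

lemma logRadial_eq_zero_of_le (hG0 : ∀ t, t ∉ Set.Ioo (-A) 0 → G t = 0) {x : Space}
    (hx : ‖x‖ ≤ Real.exp (-A)) : logRadial G x = 0 := by
  rw [logRadial, log_norm_sq, hG0, zero_smul]
  rcases eq_or_ne x 0 with rfl | hx0
  -- At the origin `Real.log 0 = 0`, which is the excluded right end of the interval.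
  · simp
  · have := (Real.log_le_iff_le_exp (norm_pos_iff.mpr hx0)).mpr hx
    exact fun h => absurd h.1 (not_lt.mpr this)

lemma hasCompactSupport_logRadial (hG0 : ∀ t, t ∉ Set.Ioo (-A) 0 → G t = 0) :
    HasCompactSupport (logRadial G) := by
  refine HasCompactSupport.intro (isCompact_closedBall 0 1) fun x hx => ?_
  have hx1 : 1 < ‖x‖ := by simpa using hx
  rw [logRadial, log_norm_sq, hG0, zero_smul]
  exact fun h => absurd h.2 (not_lt.mpr (Real.log_pos hx1).le)

lemma contDiff_logRadial (hG : ContDiff ℝ ∞ G) (hG0 : ∀ t, t ∉ Set.Ioo (-A) 0 → G t = 0) :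
    ContDiff ℝ ∞ (logRadial G) := by
  rw [contDiff_iff_contDiffAt]
  intro x
  rcases eq_or_ne x 0 with rfl | hx0
  · refine (contDiffAt_const (c := (0 : Spinor))).congr_of_eventuallyEq ?_
    filter_upwards [Metric.ball_mem_nhds (0 : Space) (Real.exp_pos (-A))] with y hy
    exact logRadial_eq_zero_of_le hG0 (by simpa using (mem_ball_zero_iff.mp hy).le)
  · have h1 : ‖x‖ ^ 2 ≠ 0 := pow_ne_zero 2 (norm_ne_zero_iff.mpr hx0)
    have h2 : ContDiffAt ℝ ∞ (fun y : Space => Real.log (‖y‖ ^ 2) / 2) x :=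
      ((contDiff_norm_sq ℝ).contDiffAt.log h1).div_const 2
    exact (hG.contDiffAt.comp x h2).smul contDiffAt_const

/-- `logRadial G` as a Schwartz spinor. -/
def logRadialSchwartz (hG : ContDiff ℝ ∞ G) (hG0 : ∀ t, t ∉ Set.Ioo (-A) 0 → G t = 0) :
    SchwartzSpinor :=
  (hasCompactSupport_logRadial hG0).toSchwartzMap (contDiff_logRadial hG hG0)

lemma coe_logRadialSchwartz (hG : ContDiff ℝ ∞ G) (hG0 : ∀ t, t ∉ Set.Ioo (-A) 0 → G t = 0) :
    (logRadialSchwartz hG hG0 : Space → Spinor) = logRadial G := rfl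

lemma partialDeriv_logRadial (hG : Differentiable ℝ G) {x : Space} (hx0 : x ≠ 0) (j : Fin 3) :
    partialDeriv j (logRadial G) x
      = (deriv G (Real.log ‖x‖) * (x j / ‖x‖ ^ 2)) • spinUp := by
  have h1 : ‖x‖ ^ 2 ≠ 0 := pow_ne_zero 2 (norm_ne_zero_iff.mpr hx0)
  have h2 := (((hasStrictFDerivAt_norm_sq x).hasFDerivAt.log h1).mul_const (1 / 2 : ℝ))
  have h3 : HasDerivAt G (deriv G (Real.log (‖x‖ ^ 2) * (1 / 2))) (Real.log (‖x‖ ^ 2) * (1 / 2)) :=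
    (hG _).hasDerivAt
  have h4 := (h3.comp_hasFDerivAt x h2).smul_const spinUp
  have h5 : logRadial G = fun y : Space => (G ∘ fun y : Space => Real.log (‖y‖ ^ 2) * (1 / 2)) y
      • spinUp := by
    funext y
    simp [logRadial, div_eq_mul_inv]
  rw [partialDeriv, h5, h4.fderiv]
  have h6 : Real.log (‖x‖ ^ 2) * (1 / 2) = Real.log ‖x‖ := by rw [← log_norm_sq]; ring
  rw [h6]
  simp
  congr 1
  field_simp
  simp [EuclideanSpace.inner_single_right]

/-- The gradient of a radial function is parallel to x, so L annihilates it. -/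
lemma spinOrbit_logRadial (hG : Differentiable ℝ G) {x : Space} (hx0 : x ≠ 0) :
    spinOrbit (logRadial G) x = logRadial G x := by
  have h (j : Fin 3) : orbital j (logRadial G) x = 0 := by
    rw [orbital, partialDeriv_logRadial hG hx0, partialDeriv_logRadial hG hx0, Complex.coe_smul,
      Complex.coe_smul, smul_smul, smul_smul, ← sub_smul]
    ring_nf
    simp
  rw [spinOrbit]
  simp only [h, act, map_zero, Finset.sum_const_zero, smul_zero, add_zero]

/-- The α_j send e₁ to the lower two components and β keeps it in the upper two, so there is no
cross term. -/
lemma norm_dirac_logRadial_sq (hG : Differentiable ℝ G) (m : ℝ) {x : Space} (hx0 : x ≠ 0) :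
    ‖dirac m (logRadial G) x‖ ^ 2
      = deriv G (Real.log ‖x‖) ^ 2 / ‖x‖ ^ 2 + m ^ 2 * G (Real.log ‖x‖) ^ 2 := by
  have hx : ‖x‖ ^ 2 = x 0 ^ 2 + x 1 ^ 2 + x 2 ^ 2 := by
    simp [EuclideanSpace.norm_sq_eq, Fin.sum_univ_three]
  have h1 : ‖x‖ ^ 2 ≠ 0 := pow_ne_zero 2 (norm_ne_zero_iff.mpr hx0)
  have key (d g : ℝ) : ‖(-Complex.I) • (∑ j : Fin 3, act (alphaMat j) ((d * x j) • spinUp))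
      + (m : ℂ) • act betaMat (g • spinUp)‖ ^ 2
      = d ^ 2 * (x 0 ^ 2 + x 1 ^ 2 + x 2 ^ 2) + m ^ 2 * g ^ 2 := by
    rw [EuclideanSpace.norm_sq_eq]
    simp [Fin.sum_univ_three, act_apply, alphaMat, betaMat, pauli, spinUp, Fintype.sum_sum_type,
      ← Complex.normSq_eq_norm_sq, Complex.normSq_apply]
    ring
  have h2 := key (deriv G (Real.log ‖x‖) / ‖x‖ ^ 2) (G (Real.log ‖x‖))
  rw [← hx] at h2
  rw [dirac]
  simp only [partialDeriv_logRadial hG hx0]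
  rw [logRadial, log_norm_sq]
  simp only [mul_div_assoc', div_mul_eq_mul_div] at h2 ⊢
  rw [h2]
  field_simp

/-- The weighted norm of `logRadial G` in logarithmic polar coordinates. -/
lemma weightedSq_logRadial (hG : Continuous G) {ρ : ℝ → ℝ} (hρ : ContinuousOn ρ (Set.Ioi 0)) :
    weightedSq ρ (logRadial G) = (volume : Measure Space).toSphere Set.univ *
      ∫⁻ t : ℝ, ENNReal.ofReal (Real.exp (3 * t) * (G t ^ 2 * ρ (Real.exp t))) := by
  simp only [weightedSq, norm_logRadial_sq]
  rw [lintegral_norm_exp (f := fun r => ENNReal.ofReal (G (Real.log r) ^ 2 * ρ r))]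
  · congr 1
    refine lintegral_congr fun t => ?_
    rw [Real.log_exp, ENNReal.ofReal_mul (Real.exp_pos _).le]
  · refine AEMeasurable.ennreal_ofReal (AEMeasurable.mul ?_ (hρ.aemeasurable measurableSet_Ioi))
    exact ((hG.measurable.comp Real.measurable_log).pow_const 2).aemeasurable

lemma weightedSq_spinOrbit_logRadial (hG : Differentiable ℝ G) (ρ : ℝ → ℝ) :
    weightedSq ρ (spinOrbit (logRadial G)) = weightedSq ρ (logRadial G) := by
  refine lintegral_congr_ae ?_
  have : ∀ᵐ x : Space, x ≠ 0 := by simp [ae_iff]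
  filter_upwards [this] with x hx
  rw [spinOrbit_logRadial hG hx]

lemma weightedSq_dirac_logRadial (hG : ContDiff ℝ 1 G) (m : ℝ) {ρ : ℝ → ℝ}
    (hρ : ContinuousOn ρ (Set.Ioi 0)) :
    weightedSq ρ (dirac m (logRadial G)) = (volume : Measure Space).toSphere Set.univ *
      ∫⁻ t : ℝ, ENNReal.ofReal (Real.exp (3 * t) *
        ((deriv G t ^ 2 * Real.exp (-(2 * t)) + m ^ 2 * G t ^ 2) * ρ (Real.exp t))) := by
  have h : weightedSq ρ (dirac m (logRadial G)) = ∫⁻ x : Space, ENNReal.ofReal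
      ((deriv G (Real.log ‖x‖) ^ 2 / ‖x‖ ^ 2 + m ^ 2 * G (Real.log ‖x‖) ^ 2) * ρ ‖x‖) := by
    refine lintegral_congr_ae ?_
    have : ∀ᵐ x : Space, x ≠ 0 := by simp [ae_iff]
    filter_upwards [this] with x hx
    rw [norm_dirac_logRadial_sq (hG.differentiable one_ne_zero) m hx]
  rw [h, lintegral_norm_exp (f := fun r => ENNReal.ofReal
    ((deriv G (Real.log r) ^ 2 / r ^ 2 + m ^ 2 * G (Real.log r) ^ 2) * ρ r))]
  · congr 1
    refine lintegral_congr fun t => ?_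
    rw [Real.log_exp, ← ENNReal.ofReal_mul (Real.exp_pos _).le, Real.exp_neg, two_mul,
      Real.exp_add, sq (Real.exp t), div_eq_mul_inv]
  · refine AEMeasurable.ennreal_ofReal (AEMeasurable.mul ?_ (hρ.aemeasurable measurableSet_Ioi))
    have h1 := hG.continuous.measurable
    have h2 := (measurable_deriv G).comp Real.measurable_log
    have h3 := h1.comp Real.measurable_log
    exact (((h2.pow_const 2).div (measurable_id.pow_const 2)).add
      ((h3.pow_const 2).const_mul _)).aemeasurable

end logRadial

/-- A smooth cutoff function on the line, supported in `[-1, 1]`. -/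
def cutoff : ContDiffBump (0 : ℝ) := ⟨1 / 2, 1, by norm_num, by norm_num⟩

lemma cutoff_eq_zero {t : ℝ} (ht : 1 ≤ |t|) : cutoff t = 0 :=
  cutoff.zero_of_le_dist (by simpa [Real.dist_eq, cutoff] using ht)

lemma contDiff_cutoff : ContDiff ℝ ∞ cutoff := cutoff.contDiff

lemma deriv_cutoff_eq_zero {t : ℝ} (ht : 1 < |t|) : deriv cutoff t = 0 := by
  have h : cutoff =ᶠ[𝓝 t] fun _ => (0 : ℝ) := by
    filter_upwards [(continuous_abs.tendsto t).eventually (lt_mem_nhds ht)] with s hs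
    exact cutoff_eq_zero hs.le
  rw [h.deriv_eq, deriv_const]

lemma continuous_deriv_cutoff : Continuous (deriv cutoff) :=
  contDiff_cutoff.continuous_deriv (by simp)

lemma hasCompactSupport_cutoff : HasCompactSupport cutoff := cutoff.hasCompactSupport

lemma integral_cutoff_sq_pos : 0 < ∫ t, cutoff t ^ 2 := by
  refine Continuous.integral_pos_of_hasCompactSupport_nonneg_nonzero (x := 0)
    (contDiff_cutoff.continuous.pow 2) ?_ (fun t => sq_nonneg _) ?_
  · exact hasCompactSupport_cutoff.comp_left (g := fun y : ℝ => y ^ 2) (by simp)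
  · have : cutoff (0 : ℝ) = 1 := cutoff.one_of_mem_closedBall (by simp [cutoff])
    simp [this]

lemma toSphere_univ_ne_zero : (volume : Measure Space).toSphere Set.univ ≠ 0 :=
  Measure.measure_univ_ne_zero.mpr (volume : Measure Space).toSphere_ne_zero

/-! ### Sharpness of the spin-orbit inequality -/

/-- The constant in the spin-orbit inequality is attained by radial spinors. -/
theorem HasHardyConstants.spinOrbit_sharp {w h : ℝ → ℝ} {γ τ : ℝ} (H : HasHardyConstants w h γ τ)
    {C c : ℝ} (hc : 0 ≤ c)
    (hC : ∀ ψ : SchwartzSpinor, HasCompactSupport ψ →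
      ENNReal.ofReal C * weightedSq (fun r => w r / h r ^ 2) ψ
        ≤ ENNReal.ofReal c * weightedSq (fun r => w r / h r ^ 2) (spinOrbit ψ)) : C ≤ c := by
  -- The shift places the support in [-3, -1], hence away from the origin and inside the unit ball.
  set G : ℝ → ℝ := fun t => cutoff (t + 2) with hGdef
  have hG : ContDiff ℝ ∞ G := contDiff_cutoff.comp (by fun_prop)
  have hG0 : ∀ t, t ∉ Set.Ioo (-(3 : ℝ)) 0 → G t = 0 := by
    intro t ht
    refine cutoff_eq_zero ?_
    rw [Set.mem_Ioo, not_and_or, not_lt, not_lt] at ht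
    rw [le_abs]
    rcases ht with ht | ht
    · right; linarith
    · left; linarith
  have hp : ContinuousOn (fun r => w r / h r ^ 2) (Set.Ioi 0) :=
    H.left.continuousOn.div (H.right.continuousOn.pow 2) fun r hr =>
      pow_ne_zero 2 (H.right.pos r hr).ne'
  have h1 := hC (logRadialSchwartz hG hG0) (hasCompactSupport_logRadial hG0)
  rw [coe_logRadialSchwartz, weightedSq_spinOrbit_logRadial (hG.differentiable (by simp)),
    weightedSq_logRadial hG.continuous hp] at h1
  set f : ℝ → ℝ := fun t =>
    Real.exp (3 * t) * (G t ^ 2 * (w (Real.exp t) / h (Real.exp t) ^ 2)) with hf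
  have hwpos (t : ℝ) : 0 < w (Real.exp t) / h (Real.exp t) ^ 2 :=
    div_pos (H.left.pos _ (Real.exp_pos t)) (pow_pos (H.right.pos _ (Real.exp_pos t)) 2)
  have hf0 (t : ℝ) : 0 ≤ f t := by have := hwpos t; positivity
  have hfc : Continuous f := by
    have h2 : Continuous fun t => w (Real.exp t) / h (Real.exp t) ^ 2 :=
      hp.comp_continuous Real.continuous_exp fun t => Real.exp_pos t
    have h3 := hG.continuous
    exact (by fun_prop : Continuous fun t : ℝ => Real.exp (3 * t)).mul ((h3.pow 2).mul h2)
  have hfs : HasCompactSupport f := by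
    refine HasCompactSupport.intro (isCompact_Icc (a := -(3 : ℝ)) (b := 0)) fun t ht => ?_
    have : G t = 0 := hG0 t fun h => ht (Set.Ioo_subset_Icc_self h)
    simp [hf, this]
  have hpos : 0 < ∫ t, f t := by
    refine hfc.integral_pos_of_hasCompactSupport_nonneg_nonzero (x := -2) hfs hf0 ?_
    have : G (-2) = 1 := cutoff.one_of_mem_closedBall (by simp [cutoff])
    simp only [hf, this]
    have := hwpos (-2)
    positivity
  rw [← ofReal_integral_eq_lintegral_ofReal (hfc.integrable_of_hasCompactSupport hfs)
    (Eventually.of_forall hf0)] at h1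
  -- Both sides contain the same integral; it is positive and finite, so it cancels.
  rw [ENNReal.mul_le_mul_iff_left (mul_ne_zero toSphere_univ_ne_zero (by simpa using hpos))
    (ENNReal.mul_ne_top (measure_ne_top _ _) ENNReal.ofReal_ne_top)] at h1
  exact (ENNReal.ofReal_le_ofReal_iff hc).mp h1

/-! ### Sharpness of the Dirac inequalities for power weights -/

lemma isRadialWeight_rpow {κ p : ℝ} (hκ : 0 < κ) (hp : -3 < p) :
    IsRadialWeight fun r => κ * r ^ p where
  pos r hr := by positivity
  locallyIntegrable x := by
    refine ⟨Metric.ball 0 (‖x‖ + 1), Metric.isOpen_ball.mem_nhds (by simp), ?_⟩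
    have h := integrableOn_fun_norm_addHaar (volume : Measure Space)
      (f := fun r => κ * r ^ p) (r := ‖x‖ + 1)
    rw [h]
    have h2 : IntegrableOn (fun r : ℝ => κ * r ^ (p + 2)) (Set.Ioo 0 (‖x‖ + 1)) :=
      ((intervalIntegral.intervalIntegrable_rpow' (by linarith : -1 < p + 2)).1.mono_set
        Set.Ioo_subset_Ioc_self).const_mul κ
    refine h2.congr_fun (fun r hr => ?_) measurableSet_Ioo
    simp only [finrank_euclideanSpace, Fintype.card_fin, Nat.add_one_sub_one, smul_eq_mul]
    rw [Real.rpow_add hr.1, Real.rpow_two]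
    ring
  absolutelyContinuous a b ha hab := by
    refine ContDiffOn.absolutelyContinuousOnInterval fun r hr => ?_
    rw [Set.uIcc_of_le hab] at hr
    exact (contDiffAt_const.mul
      (Real.contDiffAt_rpow_const_of_ne (ha.trans_le hr.1).ne')).contDiffWithinAt

lemma wronskian_rpow {κ p q r : ℝ} (hr : 0 < r) :
    (deriv (fun r : ℝ => 1 * r ^ p) r * (κ * r ^ q) - 1 * r ^ p * deriv (fun r => κ * r ^ q) r)
      / (1 * r ^ p) = κ * (p - q) * r ^ (q - 1) := by
  have h (κ p : ℝ) : deriv (fun r : ℝ => κ * r ^ p) r = κ * (p * r ^ (p - 1)) :=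
    ((Real.hasDerivAt_rpow_const (Or.inl hr.ne')).const_mul κ).deriv
  have h1 : r ^ p ≠ 0 := (Real.rpow_pos_of_pos hr p).ne'
  rw [h, h, Real.rpow_sub_one hr.ne', Real.rpow_sub_one hr.ne']
  field_simp

/-- With η = τr and ω = r^p the Wronskian quotient is the constant τ(p - 1), and p = 1 - γ/τ makes
it -γ. Moreover p ≥ -1, so ω is locally integrable. -/
lemma hasHardyConstants_linear {γ τ : ℝ} (hγ : 0 ≤ γ) (hτ : 0 < τ) (hle : γ / 2 ≤ τ) :
    HasHardyConstants (fun r => 1 * r ^ (1 - γ / τ)) (fun r => τ * r ^ (1 : ℝ)) γ τ where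
  left := by
    refine isRadialWeight_rpow one_pos ?_
    have : γ / τ ≤ 2 := by rw [div_le_iff₀ hτ]; linarith
    linarith
  right := isRadialWeight_rpow hτ (by norm_num)
  essSup_eq := by
    have hne : ∀ᵐ x : Space, x ≠ 0 := by simp [ae_iff]
    refine (essSup_congr_ae (g := fun _ => ENNReal.ofReal γ) ?_).trans
      (essSup_const _ (NeZero.ne (volume : Measure Space)))
    filter_upwards [hne] with x hx
    rw [wronskian_rpow (norm_pos_iff.mpr hx), sub_self, Real.rpow_zero, mul_one, sub_sub_cancel_left,
      mul_neg, abs_neg, mul_div_cancel₀ _ hτ.ne', abs_of_nonneg hγ]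
  essInf_eq := by
    have hne : ∀ᵐ x : Space, x ≠ 0 := by simp [ae_iff]
    refine (essInf_congr_ae (g := fun _ => ENNReal.ofReal τ) ?_).trans
      (essInf_const _ (NeZero.ne (volume : Measure Space)))
    filter_upwards [hne] with x hx
    rw [Real.rpow_one, mul_div_cancel_right₀ _ (norm_ne_zero_iff.mpr hx)]

/-- For τ = 0 a linear η is not positive. Taking ω = η kills the Wronskian, and η/|x| = |x| has
essential infimum zero without vanishing off the origin. -/
lemma hasHardyConstants_quadratic :
    HasHardyConstants (fun r => 1 * r ^ (2 : ℝ)) (fun r => 1 * r ^ (2 : ℝ)) 0 0 where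
  left := isRadialWeight_rpow one_pos (by norm_num)
  right := isRadialWeight_rpow one_pos (by norm_num)
  essSup_eq := by
    have hne : ∀ᵐ x : Space, x ≠ 0 := by simp [ae_iff]
    refine (essSup_congr_ae (g := fun _ => ENNReal.ofReal 0) ?_).trans
      (essSup_const _ (NeZero.ne (volume : Measure Space)))
    filter_upwards [hne] with x hx
    rw [wronskian_rpow (norm_pos_iff.mpr hx)]
    simp
  essInf_eq := by
    rw [ENNReal.ofReal_zero, ← nonpos_iff_eq_zero]
    refine ENNReal.le_of_forall_pos_le_add fun ε hε _ => ?_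
    rw [zero_add]
    by_contra hlt
    rw [not_le] at hlt
    have h1 : ∀ᵐ x : Space, (ε : ℝ≥0∞) < ENNReal.ofReal (1 * ‖x‖ ^ (2 : ℝ) / ‖x‖) :=
      (ae_essInf_le (μ := (volume : Measure Space))).mono fun x hx => hlt.trans_le hx
    have h2 := (Metric.measure_ball_pos (volume : Measure Space) 0
      (NNReal.coe_pos.mpr hε)).ne'
    refine h2 (measure_mono_null (fun x hx => ?_) h1)
    have hx' : ‖x‖ < ε := by simpa using hx
    simp only [Set.mem_compl_iff, Set.mem_ofPred_eq, not_lt, one_mul, Real.rpow_two]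
    rw [sq, mul_self_div_self]
    exact ENNReal.ofReal_le_of_le_toReal (by simpa using hx'.le)

/-- Test functions concentrating at the origin determine the best constant in the inequality with
power weights. -/
lemma rpow_const_le {C κ p q a b m ε : ℝ} (hκ : 0 < κ) (ha : 2 * a = p - 2 * q + 3)
    (hb : b = q - 1) (hb0 : 0 ≤ b)
    (hε : Tendsto (fun n : ℕ => Real.exp (-(2 * b * n))) atTop (𝓝 ε))
    (hC : ∀ (G : ℝ → ℝ) (A : ℝ), ContDiff ℝ ∞ G → (∀ t, t ∉ Set.Ioo (-A) 0 → G t = 0) →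
      ENNReal.ofReal C * weightedSq (fun r => 1 * r ^ p / (κ * r ^ q) ^ 2) (logRadial G)
        ≤ weightedSq (fun r => 1 * r ^ p) (dirac m (logRadial G))) :
    C ≤ ε * (a * κ) ^ 2 := by
  have hε0 : 0 ≤ ε := ge_of_tendsto' hε fun n => (Real.exp_pos _).le
  -- `ENNReal.ofReal C` forgets negative values, but for C ≤ 0 the bound is trivial.
  rcases le_or_gt C 0 with hC0 | hC0
  · exact hC0.trans (by positivity)
  have hφ := contDiff_cutoff
  have hφ' := continuous_deriv_cutoff
  have hφc := hφ.continuous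
  set I := ∫ t, cutoff t ^ 2 with hI
  set J := ∫ t, deriv cutoff t ^ 2 with hJ
  set M := ∫ t, cutoff t * deriv cutoff t with hM
  have hIpos : 0 < I := integral_cutoff_sq_pos
  have supp {f : ℝ → ℝ} (hf : ∀ t, 1 < |t| → f t = 0) : HasCompactSupport f := by
    refine HasCompactSupport.intro (isCompact_Icc (a := -(1 : ℝ)) (b := 1)) fun t ht => hf t ?_
    rw [Set.mem_Icc, ← abs_le, not_le] at ht
    exact ht
  have int1 : Integrable fun t => cutoff t ^ 2 :=
    (hφc.pow 2).integrable_of_hasCompactSupport (supp fun t ht => by simp [cutoff_eq_zero ht.le])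
  have int2 : Integrable fun t => deriv cutoff t ^ 2 :=
    (hφ'.pow 2).integrable_of_hasCompactSupport
      (supp fun t ht => by simp [deriv_cutoff_eq_zero ht])
  have int3 : Integrable fun t => cutoff t * deriv cutoff t :=
    (hφc.mul hφ').integrable_of_hasCompactSupport
      (supp fun t ht => by simp [cutoff_eq_zero ht.le])
  have main (n : ℕ) (hn : 1 ≤ n) : C * ((κ ^ 2)⁻¹ * I) ≤
      Real.exp (-(2 * b * n)) * (J * (1 / n) ^ 2 - 2 * a * (1 / n) * M + a ^ 2 * I)
        + m ^ 2 * Real.exp (-(2 * n)) * I := by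
    have hn0 : (0 : ℝ) < n := by positivity
    -- The exponential cancels the weight ω/η² together with the volume factor e^{3t}. The cutoff
    -- has width of order n and lives on [-3n, -n], so its derivative is O(1/n) and it concentrates
    -- at the origin.
    set G : ℝ → ℝ := fun t => Real.exp (-(a * t)) * cutoff (t / n + 2) with hGdef
    have hG : ContDiff ℝ ∞ G :=
      (Real.contDiff_exp.comp (by fun_prop)).mul (hφ.comp (by fun_prop))
    have hG0 : ∀ t, t ∉ Set.Ioo (-(3 * n : ℝ)) 0 → G t = 0 := by
      intro t ht
      rw [hGdef]
      simp only
      rw [cutoff_eq_zero, mul_zero]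
      rw [Set.mem_Ioo, not_and_or, not_lt, not_lt] at ht
      rw [le_abs]
      rcases ht with ht | ht
      · right
        have : t / n ≤ -3 := by rw [div_le_iff₀ hn0]; linarith
        linarith
      · left
        have : 0 ≤ t / n := by positivity
        linarith
    have hGd (t : ℝ) : deriv G t = Real.exp (-(a * t)) *
        (deriv cutoff (t / n + 2) * (1 / n) - a * cutoff (t / n + 2)) := by
      have h1 : HasDerivAt (fun t : ℝ => t / n + 2) (1 / n : ℝ) t :=
        ((hasDerivAt_id t).div_const (n : ℝ)).add_const 2
      have h2 : HasDerivAt (fun t : ℝ => -(a * t)) (-a) t := by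
        simpa using ((hasDerivAt_id t).const_mul a).fun_neg
      have h3 : HasDerivAt cutoff (deriv cutoff (t / n + 2)) (t / n + 2) :=
        (hφ.differentiable (by simp) _).hasDerivAt
      have h4 := h2.exp.mul (HasDerivAt.comp t h3 h1)
      rw [show deriv G t = _ from h4.deriv]
      simp only [Function.comp_apply]
      ring
    have key := hC G (3 * n) hG hG0
    have hcw : ContinuousOn (fun r : ℝ => 1 * r ^ p) (Set.Ioi 0) :=
      continuousOn_const.mul (continuousOn_id.rpow_const fun r hr => Or.inl (ne_of_gt hr))
    have hch : ContinuousOn (fun r : ℝ => κ * r ^ q) (Set.Ioi 0) :=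
      continuousOn_const.mul (continuousOn_id.rpow_const fun r hr => Or.inl (ne_of_gt hr))
    have hcp : ContinuousOn (fun r : ℝ => 1 * r ^ p / (κ * r ^ q) ^ 2) (Set.Ioi 0) :=
      hcw.div (hch.pow 2) fun r hr =>
        pow_ne_zero 2 (mul_pos hκ (Real.rpow_pos_of_pos hr q)).ne'
    rw [weightedSq_logRadial hG.continuous hcp,
      weightedSq_dirac_logRadial (hG.of_le (by simp)) m hcw, mul_left_comm,
      ENNReal.mul_le_mul_iff_right toSphere_univ_ne_zero (measure_ne_top _ _)] at key
    have hexp (t s : ℝ) : Real.exp t ^ s = Real.exp (t * s) := (Real.exp_mul t s).symm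
    have el (t : ℝ) : Real.exp (3 * t) * (G t ^ 2 * (1 * Real.exp t ^ p / (κ * Real.exp t ^ q) ^ 2))
        = (κ ^ 2)⁻¹ * cutoff (t / n + 2) ^ 2 := by
      have e1 : Real.exp (3 * t) * Real.exp (-(a * t)) ^ 2 * Real.exp (t * p)
          = Real.exp (t * q) ^ 2 := by
        rw [← Real.exp_nat_mul, ← Real.exp_nat_mul, ← Real.exp_add, ← Real.exp_add]
        congr 1
        push_cast
        linear_combination (-t) * ha
      rw [hexp, hexp, hGdef]
      simp only
      rw [mul_pow, mul_pow, one_mul, mul_div_assoc']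
      have e2 : Real.exp (t * q) ≠ 0 := (Real.exp_pos _).ne'
      rw [mul_div_assoc', div_eq_iff (by positivity), ← e1]
      field_simp
    set g : ℝ → ℝ := fun s => Real.exp (-(2 * b * n)) * (deriv cutoff s * (1 / n) - a * cutoff s) ^ 2
      + m ^ 2 * Real.exp (-(2 * n)) * cutoff s ^ 2 with hg
    -- After the same cancellation the gradient term keeps e^{2bt} and the mass term e^{2(b+1)t}.
    -- Both are largest at the right end t = -n of the support, as b ≥ 0.
    have er (t : ℝ) : Real.exp (3 * t) * ((deriv G t ^ 2 * Real.exp (-(2 * t)) + m ^ 2 * G t ^ 2)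
        * (1 * Real.exp t ^ p)) ≤ g (t / n + 2) := by
      have e1 : Real.exp (3 * t) * Real.exp (-(a * t)) ^ 2 * Real.exp (t * p)
          = Real.exp (2 * (b + 1) * t) := by
        rw [← Real.exp_nat_mul, ← Real.exp_add, ← Real.exp_add]
        congr 1
        push_cast
        linear_combination (-t) * ha - 2 * t * hb
      have e2 : Real.exp (2 * (b + 1) * t) * Real.exp (-(2 * t)) = Real.exp (2 * b * t) := by
        rw [← Real.exp_add]
        congr 1
        ring
      have e3 : Real.exp (3 * t) * ((deriv G t ^ 2 * Real.exp (-(2 * t)) + m ^ 2 * G t ^ 2)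
          * (1 * Real.exp t ^ p)) = Real.exp (2 * b * t) *
            (deriv cutoff (t / n + 2) * (1 / n) - a * cutoff (t / n + 2)) ^ 2
          + m ^ 2 * Real.exp (2 * (b + 1) * t) * cutoff (t / n + 2) ^ 2 := by
        rw [hGd, hexp, hGdef, ← e2, ← e1]
        ring
      rw [e3, hg]
      rcases le_or_gt t (-n) with ht | ht
      · simp only
        have b1 : 2 * b * t ≤ -(2 * b * n) := by nlinarith
        have b2 : 2 * (b + 1) * t ≤ -(2 * n) := by nlinarith
        gcongr
      · have h1 : 1 < t / n + 2 := by
          have : -1 < t / n := by rw [lt_div_iff₀ hn0]; linarith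
          linarith
        have h2 : 1 < |t / n + 2| := lt_abs.mpr (Or.inl h1)
        simp [cutoff_eq_zero h2.le, deriv_cutoff_eq_zero h2]
    have hscale (f : ℝ → ℝ) : ∫ t : ℝ, f (t / n + 2) = n * ∫ t, f t := by
      have h1 := Measure.integral_comp_div (fun t => f (t + 2)) (n : ℝ)
      rw [h1, integral_add_right_eq_self f (2 : ℝ), abs_of_pos hn0, smul_eq_mul]
    have hcomp {f : ℝ → ℝ} (hf : Integrable f) : Integrable fun t : ℝ => f (t / n + 2) :=
      (hf.comp_add_right 2).comp_div hn0.ne'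
    have hgexp : g = fun s => Real.exp (-(2 * b * n)) * (deriv cutoff s ^ 2 * (1 / n) ^ 2
        - 2 * a * (1 / n) * (cutoff s * deriv cutoff s) + a ^ 2 * cutoff s ^ 2)
        + m ^ 2 * Real.exp (-(2 * n)) * cutoff s ^ 2 := by
      funext s; rw [hg]; ring
    have i1 := ((int2.mul_const ((1 / n : ℝ) ^ 2)).sub (int3.const_mul (2 * a * (1 / n))))
    have i2 := i1.add (int1.const_mul (a ^ 2))
    simp only [Pi.sub_def, Pi.add_def] at i1 i2
    have hgint : Integrable g := by
      rw [hgexp]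
      exact (i2.const_mul _).add (int1.const_mul _)
    have hgI : ∫ s, g s = Real.exp (-(2 * b * n)) * (J * (1 / n) ^ 2 - 2 * a * (1 / n) * M
        + a ^ 2 * I) + m ^ 2 * Real.exp (-(2 * n)) * I := by
      rw [hgexp, integral_add (i2.const_mul _) (int1.const_mul _), integral_const_mul,
        integral_const_mul, integral_add i1 (int1.const_mul _),
        integral_sub (int2.mul_const _) (int3.const_mul _), integral_const_mul,
        integral_const_mul, integral_mul_const]
    have hg0 (s : ℝ) : 0 ≤ g s := by simp only [hg]; positivity
    simp only [el] at key
    have key2 := key.trans (lintegral_mono fun t => ENNReal.ofReal_le_ofReal (er t))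
    rw [← ofReal_integral_eq_lintegral_ofReal ((hcomp int1).const_mul _)
        (Eventually.of_forall fun t => by positivity),
      ← ofReal_integral_eq_lintegral_ofReal (hcomp hgint) (Eventually.of_forall fun t => hg0 _),
      ← ENNReal.ofReal_mul hC0.le,
      ENNReal.ofReal_le_ofReal_iff (integral_nonneg fun t => hg0 _), integral_const_mul,
      hscale (fun t => cutoff t ^ 2), hscale g, hgI] at key2
    -- Substituting s = t/n + 2 puts the same factor n on both sides.
    refine le_of_mul_le_mul_left (le_trans (le_of_eq ?_) key2) hn0
    ring
  have hinv : Tendsto (fun n : ℕ => (1 / n : ℝ)) atTop (𝓝 0) := tendsto_one_div_atTop_nhds_zero_nat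
  have hexp0 : Tendsto (fun n : ℕ => Real.exp (-(2 * n))) atTop (𝓝 0) := by
    refine Real.tendsto_exp_neg_atTop_nhds_zero.comp ?_
    exact tendsto_natCast_atTop_atTop.const_mul_atTop two_pos
  have hlim := (hε.mul ((((hinv.pow 2).const_mul J).sub
    ((hinv.const_mul (2 * a)).mul_const M)).add_const (a ^ 2 * I))).add
    ((hexp0.const_mul (m ^ 2)).mul_const I)
  -- As n → ∞ the terms with J, M and the mass vanish; only a² ∫ cutoff² survives.
  have hfin : C * ((κ ^ 2)⁻¹ * I) ≤ ε * (a ^ 2 * I) := by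
    have := ge_of_tendsto hlim ((eventually_ge_atTop 1).mono main)
    simpa using this
  have h1 : C * (κ ^ 2)⁻¹ ≤ ε * a ^ 2 := by
    refine le_of_mul_le_mul_right ?_ hIpos
    linarith
  rw [← div_eq_mul_inv, div_le_iff₀ (by positivity)] at h1
  linarith

/-- For power weights with the given constants, the Dirac inequality holds with no larger
constant. -/
theorem exists_sharp_weights {γ τ : ℝ} (hγ : 0 ≤ γ) (hτ : γ / 2 ≤ τ) :
    ∃ w h : ℝ → ℝ, HasHardyConstants w h γ τ ∧ ∀ m C : ℝ,
      (∀ (G : ℝ → ℝ) (A : ℝ), ContDiff ℝ ∞ G → (∀ t, t ∉ Set.Ioo (-A) 0 → G t = 0) →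
        ENNReal.ofReal C * weightedSq (fun r => w r / h r ^ 2) (logRadial G)
          ≤ weightedSq w (dirac m (logRadial G))) →
      C ≤ (τ - γ / 2) ^ 2 := by
  rcases (by linarith : 0 ≤ τ).eq_or_lt with h0 | h0
  -- Here b = 1, so e^{-2bn} → 0 and the best constant is zero.
  · obtain rfl : τ = 0 := h0.symm
    obtain rfl : γ = 0 := by linarith
    refine ⟨_, _, hasHardyConstants_quadratic, fun m C hC => ?_⟩
    have hexp : Tendsto (fun n : ℕ => Real.exp (-(2 * 1 * n))) atTop (𝓝 0) := by
      refine Real.tendsto_exp_neg_atTop_nhds_zero.comp ?_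
      exact tendsto_natCast_atTop_atTop.const_mul_atTop (by norm_num)
    have := rpow_const_le (a := 1 / 2) one_pos (by norm_num) (by norm_num) zero_le_one hexp hC
    simpa using this
  · refine ⟨_, _, hasHardyConstants_linear hγ h0 hτ, fun m C hC => ?_⟩
    -- Here b = 0, so the limit is 1, and aκ = (1 - γ/(2τ))τ = τ - γ/2.
    have hexp : Tendsto (fun n : ℕ => Real.exp (-(2 * 0 * n))) atTop (𝓝 1) := by simp
    have := rpow_const_le (a := 1 - γ / (2 * τ)) h0 (by field_simp; ring) (by norm_num) le_rfl
      hexp hC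
    refine this.trans (le_of_eq ?_)
    field_simp

end HardyDirac

end

/-! ### The theorem -/

theorem theorem1 (γ τ : ℝ) (hγ : 0 ≤ γ) (hτ : γ / 2 ≤ τ) :
    -- the inequalities, for all weights with these constants, and optimality of the first one
    (∀ w h : ℝ → ℝ, HardyDirac.HasHardyConstants w h γ τ → ∀ m : ℝ, 0 ≤ m →
      (∀ ψ : 𝓢(HardyDirac.Space, HardyDirac.Spinor),
        ENNReal.ofReal ((τ - γ / 2) ^ 2) *
            HardyDirac.weightedSq (fun r => w r / h r ^ 2) ψ
          ≤ ENNReal.ofReal ((τ - γ / 2) ^ 2) *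
            HardyDirac.weightedSq (fun r => w r / h r ^ 2) (HardyDirac.spinOrbit ψ) ∧
        ENNReal.ofReal ((τ - γ / 2) ^ 2) *
            HardyDirac.weightedSq (fun r => w r / h r ^ 2) (HardyDirac.spinOrbit ψ)
          ≤ HardyDirac.weightedSq w (HardyDirac.dirac m ψ)) ∧
      (∀ ψ χ φ : HardyDirac.Space → HardyDirac.Spinor,
        HardyDirac.IsEnergyLimit m w h ψ χ φ →
        ENNReal.ofReal ((τ - γ / 2) ^ 2) *
            HardyDirac.weightedSq (fun r => w r / h r ^ 2) ψ
          ≤ ENNReal.ofReal ((τ - γ / 2) ^ 2) *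
            HardyDirac.weightedSq (fun r => w r / h r ^ 2) χ ∧
        ENNReal.ofReal ((τ - γ / 2) ^ 2) *
            HardyDirac.weightedSq (fun r => w r / h r ^ 2) χ
          ≤ HardyDirac.weightedSq w φ) ∧
      (∀ C : ℝ,
        (∀ ψ : 𝓢(HardyDirac.Space, HardyDirac.Spinor), HasCompactSupport ψ →
          ENNReal.ofReal C * HardyDirac.weightedSq (fun r => w r / h r ^ 2) ψ
            ≤ ENNReal.ofReal ((τ - γ / 2) ^ 2) *
              HardyDirac.weightedSq (fun r => w r / h r ^ 2) (HardyDirac.spinOrbit ψ)) →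
        C ≤ (τ - γ / 2) ^ 2)) ∧
    -- no larger constant depending on `γ`, `τ` is valid for all weights with these constants
    (∃ w h : ℝ → ℝ, HardyDirac.HasHardyConstants w h γ τ ∧ ∀ m : ℝ, 0 ≤ m →
      (∀ C : ℝ,
        (∀ ψ : 𝓢(HardyDirac.Space, HardyDirac.Spinor), HasCompactSupport ψ →
          ENNReal.ofReal C * HardyDirac.weightedSq (fun r => w r / h r ^ 2) ψ
            ≤ HardyDirac.weightedSq w (HardyDirac.dirac m ψ)) →
        C ≤ (τ - γ / 2) ^ 2) ∧
      (∀ C : ℝ,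
        (∀ ψ : 𝓢(HardyDirac.Space, HardyDirac.Spinor), HasCompactSupport ψ →
          ENNReal.ofReal C *
              HardyDirac.weightedSq (fun r => w r / h r ^ 2) (HardyDirac.spinOrbit ψ)
            ≤ HardyDirac.weightedSq w (HardyDirac.dirac m ψ)) →
        C ≤ (τ - γ / 2) ^ 2)) := by
  refine ⟨fun w h H m _ => ⟨H.inequalities hγ hτ m, fun ψ χ φ hlim =>
    H.inequalities_of_isEnergyLimit hγ hτ m hlim, fun C hC =>
    H.spinOrbit_sharp (sq_nonneg _) hC⟩, ?_⟩
  obtain ⟨w, h, H, hs⟩ := HardyDirac.exists_sharp_weights hγ hτ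
  refine ⟨w, h, H, fun m _ => ⟨fun C hC => hs m C fun G A hG hG0 => ?_,
    fun C hC => hs m C fun G A hG hG0 => ?_⟩⟩
  · exact hC (HardyDirac.logRadialSchwartz hG hG0) (HardyDirac.hasCompactSupport_logRadial hG0)
  -- On the radial test spinors K is the identity, so this inequality coincides with the previous
  -- one.
  · have := hC (HardyDirac.logRadialSchwartz hG hG0) (HardyDirac.hasCompactSupport_logRadial hG0)
    rwa [HardyDirac.coe_logRadialSchwartz,
      HardyDirac.weightedSq_spinOrbit_logRadial (hG.differentiable (by simp))] at this
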